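/- Let $m\ge 0$ and $n_1,\dots,n_m\ge 1$ be integers, $n=\sum_i n_i$. Let $\Delta^{q}=\{x\in\mathbb R^{q+1}: x_j\ge 0,\ \sum_j x_j=1\}$ and $P=\prod_{i=1}^m\Delta^{n_i}$, with facets $F^i_j=\{x\in P: x^i_j=0\}$ ($1\le i\le m$, $0\le j\le n_i$). Write $G=(S^1)^n$, with the coordinates of $t\in G$ indexed as $t^i_k$ ($1\le i\le m$, $1\le k\le n_i$). *Quasitoric manifolds.* A quasitoric manifold over $P$ is a $2n$-dimensional smooth manifold $M$ (Hausdorff, second countable) with a smooth action of $G$ and a map $\pi:M\to P$ such that: every point of $M$ has a $G$-invariant open neighbourhood that is $G$-equivariantly diffeomorphic to an open subset of a faithful real $2n$-dimensional representation of $G$; every fiber of $\pi$ is a $G$-orbit; and $\pi$ identifies $M/G$ with $P$, i.e. $\pi$ is a topological quotient map and the isotropy group of $x\in M$ is a torus whose rank is the number of facets of $P$ containing $\pi(x)$. A characteristic function of $M$ assigns to each facet $F$ a primitive vector $\lambda(F)\in\mathrm{Hom}(S^1,G)\cong\mathbb Z^n$ whose image is the isotropy group of every point of $\pi^{-1}(\mathrm{int}\,F)$;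 it is unique up to the sign of each $\lambda(F)$. *Vector matrices.* An $m\times m$ vector matrix $A$ has entries $\mathbf a^j_i=[a^j_{i1},\dots,a^j_{in_j}]\in\mathbb Z^{n_j}$ in row $i$ and column $j$. Its principal minors are the principal minors (full determinant included) of the $m\times m$ integer matrices $A_{k_1\ldots k_m}=(a^j_{ik_j})_{i,j}$, $1\le k_j\le n_j$. $A$ is associated with $M$ if, for some characteristic function $\lambda$ of $M$, the vectors $\lambda(F^j_k)$ ($1\le j\le m$, $1\le k\le n_j$) form a basis of $\mathrm{Hom}(S^1,G)$ and $\lambda(F^i_0)=\sum_{j,k}a^j_{ik}\,\lambda(F^j_k)$ for every $i$. **Proposition 4.3.** Let $A$ be an $m\times m$ vector matrix all of whose principal minors are $\pm1$. Let $K=(S^1)^m$ act on $X=\prod_{i=1}^m S^{2n_i+1}\subset\prod_{i=1}^m\mathbb C^{n_i+1}$ by $$(g\cdot z)^i_0=g_i\,z^i_0,\qquad (g\cdot z)^i_k=\Big(\prod_{l=1}^m g_l^{\,a^i_{lk}}\Big)z^i_k\quad(1\le k\le n_i).$$ Then this action is free, and the orbit space $M(A)=X/K$ has a smooth structure for which $X\to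 M(A)$ is a smooth submersion and with which $M(A)$, with the $G$-action $t\cdot[z]=[z']$, $z'^i_0=z^i_0$, $z'^i_k=t^i_kz^i_k$ ($1\le k\le n_i$), and with the projection $\pi([z])=(|z^i_j|^2)_{i,j}$, is a quasitoric manifold over $P$. Moreover $A$ is associated with $M(A)$. -/

import Mathlib

open scoped Manifold ContDiff

noncomputable section

namespace Quasitoric

variable {m : ℕ}

/-! ### Vector matrices and their principal minors -/

/-- An `m × m` vector matrix: its entry in row `i` and column `j` is a vector `A i j` in `ℤ ^ (n j)`.
Its `k`-th component `A i j k` is the integer written `a^j_{ik}`. -/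
abbrev VectorMatrix (n : Fin m → ℕ) : Type := ∀ _i j : Fin m, Fin (n j) → ℤ

/-- The `m × m` integer matrix obtained by choosing, for every `j`, the component `k j` of the vectors
in the `j`-th column. -/
def VectorMatrix.select {n : Fin m → ℕ} (A : VectorMatrix n) (k : ∀ j, Fin (n j)) :
    Matrix (Fin m) (Fin m) ℤ :=
  Matrix.of fun i j => A i j (k j)

/-- All principal minors of the vector matrix, that is, all principal minors (the full determinant
included) of all the matrices `A.select k`, are `1` or `-1`. The minor for `S = ∅` is `1`. -/
def VectorMatrix.UnimodularMinors {n : Fin m → ℕ} (A : VectorMatrix n) : Prop :=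
  ∀ (k : ∀ j, Fin (n j)) (S : Finset (Fin m)),
    ((A.select k).submatrix (Subtype.val : S → Fin m) (Subtype.val : S → Fin m)).det = 1 ∨
    ((A.select k).submatrix (Subtype.val : S → Fin m) (Subtype.val : S → Fin m)).det = -1

/-! ### The product of simplices and its facets -/

/-- The product `∏ Δ^(n i)`, each simplex being the standard one in `ℝ ^ (n i + 1)`. -/
abbrev SimplexProd (n : Fin m → ℕ) : Type := ∀ i, stdSimplex ℝ (Fin (n i + 1))

/-- The labels `(i, j)`, `0 ≤ j ≤ n i`, of the facets of the product of simplices. -/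
abbrev FacetIdx (n : Fin m → ℕ) : Type := Σ i, Fin (n i + 1)

/-- The facet `F^i_j`: the product of the face of `Δ^(n i)` opposite to the vertex `j` with the other
simplices. -/
def facet (n : Fin m → ℕ) (f : FacetIdx n) : Set (SimplexProd n) :=
  {p | (p f.1 : Fin (n f.1 + 1) → ℝ) f.2 = 0}

/-- The relative interior of a facet: the points that lie on this facet and on no other one. -/
def facetInterior (n : Fin m → ℕ) (f : FacetIdx n) : Set (SimplexProd n) :=
  {p | p ∈ facet n f ∧ ∀ f' : FacetIdx n, p ∈ facet n f' → f' = f}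

/-! ### Quasitoric manifolds over the product of simplices -/

/-- The labels of the coordinates of `(S^1)^n`, `n = ∑ n i`, in `m` groups of `n i` coordinates. -/
abbrev CoordIdx (n : Fin m → ℕ) : Type := Σ i, Fin (n i)

/-- The torus `(S^1)^n` with `n = ∑ n i`. -/
abbrev Torus (n : Fin m → ℕ) : Type := CoordIdx n → Circle

/-- The model space `ℝ ^ (2 n)` with `n = ∑ n i`. -/
abbrev Model (n : Fin m → ℕ) : Type := EuclideanSpace ℝ (Fin (2 * ∑ i, n i))

/-- The manifold structure on the torus `(S^1)^n` as a product of circles. -/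
abbrev torusModel (n : Fin m → ℕ) :=
  ModelWithCorners.pi (fun _ : CoordIdx n => 𝓡 1)

/-- `M`, with the given charts, action of `(S^1)^n` and projection `π`, is a quasitoric manifold over
the product of simplices. -/
structure IsQuasitoricManifold (n : Fin m → ℕ) (M : Type*) [TopologicalSpace M]
    [ChartedSpace (Model n) M] [MulAction (Torus n) M] (π : M → SimplexProd n) : Prop where
  /-- `M` is a smooth manifold, of dimension `2 n`. -/
  isManifold : IsManifold (𝓘(ℝ, Model n)) ∞ M
  t2Space : T2Space M
  secondCountable : SecondCountableTopology M
  /-- The torus acts smoothly. -/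
  smooth_smul : ContMDiffSMul (torusModel n) (𝓘(ℝ, Model n)) ∞ (Torus n) M
  /-- `M` is locally isomorphic to a faithful real representation of the torus of dimension `2 n`:
  every point has an invariant open neighbourhood with an equivariant diffeomorphism onto an open
  subset of such a representation. -/
  locally_representation : ∀ x : M,
    ∃ (ρ : Torus n →* (Model n →L[ℝ] Model n)) (e : OpenPartialHomeomorph M (Model n)),
      Continuous ρ ∧ Function.Injective ρ ∧
      e ∈ IsManifold.maximalAtlas (𝓘(ℝ, Model n)) ∞ M ∧ x ∈ e.source ∧
      ∀ (t : Torus n), ∀ y ∈ e.source, t • y ∈ e.source ∧ e (t • y) = ρ t (e y)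
  /-- Every fiber of the projection is an orbit. -/
  fiber_eq_orbit : ∀ p : SimplexProd n, ∃ x : M, π ⁻¹' {p} = MulAction.orbit (Torus n) x
  /-- The projection identifies the orbit space with the product of simplices, topologically ... -/
  isQuotientMap : Topology.IsQuotientMap π
  /-- ... and compatibly with faces: the isotropy group of a point over the relative interior of a
  face of codimension `c` (a face contained in exactly `c` facets) is a torus of rank `c`. -/
  stabilizer_torus : ∀ x : M, Nonempty
    (MulAction.stabilizer (Torus n) x ≃ₜ* ({f : FacetIdx n // π x ∈ facet n f} → Circle))

/-- The group `Hom(S^1, (S^1)^n)` of continuous homomorphisms, written additively. -/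
abbrev Cochar (n : Fin m → ℕ) : Type := Additive (Circle →ₜ* Torus n)

/-- A primitive vector: not a multiple of another one by an integer other than `±1`. -/
def IsPrimitiveVector {n : Fin m → ℕ} (v : Cochar n) : Prop :=
  ∀ (d : ℤ) (w : Cochar n), v = d • w → IsUnit d

/-- `lam` is a characteristic function of `π : M → ∏ Δ^(n i)`: for every facet `F`, the vector `lam F`
is primitive and its image is the isotropy subgroup of every point over the relative interior of `F`
(so that `lam F` is determined up to sign). -/
def IsCharacteristicFunction {n : Fin m → ℕ} {M : Type*} [MulAction (Torus n) M]
    (π : M → SimplexProd n) (lam : FacetIdx n → Cochar n) : Prop :=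
  ∀ f : FacetIdx n, IsPrimitiveVector (lam f) ∧
    ∀ x : M, π x ∈ facetInterior n f →
      MulAction.stabilizer (Torus n) x = ((lam f).toMul : Circle →* Torus n).range

/-- `A` is the vector matrix associated with `π : M → ∏ Δ^(n i)`: for some characteristic function,
the vectors of the facets `F^i_j`, `j ≥ 1`, form a basis of `Hom(S^1, (S^1)^n)`, and the coordinates
of the vector of `F^i_0` in this basis form the `i`-th row of `A`. -/
def HasAssociatedMatrix {n : Fin m → ℕ} {M : Type*} [MulAction (Torus n) M]
    (π : M → SimplexProd n) (A : VectorMatrix n) : Prop :=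
  ∃ lam : FacetIdx n → Cochar n, IsCharacteristicFunction π lam ∧
    ∃ b : Module.Basis (CoordIdx n) ℤ (Cochar n),
      (∀ (i : Fin m) (k : Fin (n i)), b ⟨i, k⟩ = lam ⟨i, k.succ⟩) ∧
      ∀ (i j : Fin m) (k : Fin (n j)), b.repr (lam ⟨i, 0⟩) ⟨j, k⟩ = A i j k

/-! ### The product of spheres, the action of `K` and the quotient -/

/-- The real dimension of `ℂ ^ (k + 1)`, in the form in which it yields the manifold structure of its
unit sphere, of dimension `2 k + 1`. -/
instance finrankFact (k : ℕ) :
    Fact (Module.finrank ℝ (EuclideanSpace ℂ (Fin (k + 1))) = 2 * k + 1 + 1) :=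
  ⟨by
    rw [← Module.finrank_mul_finrank ℝ ℂ, Complex.finrank_real_complex, finrank_euclideanSpace_fin]
    ring⟩

/-- The product of unit spheres `X = ∏ S^(2 n i + 1)`, with `S^(2 n i + 1) ⊂ ℂ ^ (n i + 1)`. -/
abbrev SphereProd (n : Fin m → ℕ) : Type :=
  ∀ i, Metric.sphere (0 : EuclideanSpace ℂ (Fin (n i + 1))) 1

/-- The manifold structure on `X` as a product of spheres. -/
abbrev sphereModel (n : Fin m → ℕ) :=
  ModelWithCorners.pi (fun i => 𝓡 (2 * n i + 1))

/-- Multiplication of the coordinates `z^i_j` of a point of `X` by numbers `w^i_j` in `S^1`. -/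
def rotate {n : Fin m → ℕ} (w : ∀ i, Fin (n i + 1) → Circle) (z : SphereProd n) : SphereProd n :=
  fun i => ⟨WithLp.toLp 2 fun j => (w i j : ℂ) * (z i : EuclideanSpace ℂ (Fin (n i + 1))) j, by
    have h := (z i).2
    rw [mem_sphere_zero_iff_norm, EuclideanSpace.norm_eq] at h ⊢
    simpa [Circle.norm_coe] using h⟩

/-- The numbers by which `g ∈ K` multiplies the coordinates: `g_i` for `z^i_0`, and
`∏_l g_l ^ (a^i_{lk})` for `z^i_k` with `k ≥ 1`. -/
def kWeight {n : Fin m → ℕ} (A : VectorMatrix n) (g : Fin m → Circle) (i : Fin m) :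
    Fin (n i + 1) → Circle :=
  Fin.cases (g i) fun k => ∏ l, g l ^ A l i k

/-- The action of `K = (S^1)^m` on the product of spheres determined by `A`. -/
@[reducible] def kAction {n : Fin m → ℕ} (A : VectorMatrix n) :
    MulAction (Fin m → Circle) (SphereProd n) where
  smul g z := rotate (kWeight A g) z
  one_smul z := by
    change rotate (kWeight A 1) z = z
    ext i j
    refine Fin.cases ?_ (fun k => ?_) j <;> simp [rotate, kWeight]
  mul_smul g h z := by
    change rotate (kWeight A (g * h)) z = rotate (kWeight A g) (rotate (kWeight A h) z)
    ext i j
    refine Fin.cases ?_ (fun k => ?_) j <;>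
      simp [rotate, kWeight, mul_zpow, Finset.prod_mul_distrib, mul_assoc]

/-- The equivalence relation on `X` whose classes are the orbits of `K`. -/
@[reducible] def orbitSetoid {n : Fin m → ℕ} (A : VectorMatrix n) : Setoid (SphereProd n) :=
  @MulAction.orbitRel (Fin m → Circle) (SphereProd n) _ (kAction A)

theorem orbitSetoid_iff {n : Fin m → ℕ} (A : VectorMatrix n) (z z' : SphereProd n) :
    (orbitSetoid A).r z z' ↔ ∃ g : Fin m → Circle, rotate (kWeight A g) z' = z :=
  Iff.rfl

/-- The orbit space `M(A) = X / K`, with the quotient topology. -/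
def OrbitSpace {n : Fin m → ℕ} (A : VectorMatrix n) : Type := Quotient (orbitSetoid A)

instance {n : Fin m → ℕ} (A : VectorMatrix n) : TopologicalSpace (OrbitSpace A) :=
  inferInstanceAs (TopologicalSpace (Quotient (orbitSetoid A)))

/-- The quotient map `X → M(A)`. -/
def OrbitSpace.mk {n : Fin m → ℕ} (A : VectorMatrix n) : SphereProd n → OrbitSpace A :=
  Quotient.mk (orbitSetoid A)

/-- The numbers by which `t ∈ (S^1)^n` multiplies the coordinates: `1` for `z^i_0`, and the coordinate
`t^i_k` for `z^i_k` with `k ≥ 1`. -/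
def gWeight {n : Fin m → ℕ} (t : Torus n) (i : Fin m) : Fin (n i + 1) → Circle :=
  Fin.cases 1 fun k => t ⟨i, k⟩

theorem rotate_rotate {n : Fin m → ℕ} (v w : ∀ i, Fin (n i + 1) → Circle) (z : SphereProd n) :
    rotate v (rotate w z) = rotate (v * w) z := by
  ext i j
  simp [rotate, mul_assoc]

/-- The residual action of `(S^1)^n` on `M(A)`. -/
instance {n : Fin m → ℕ} (A : VectorMatrix n) : MulAction (Torus n) (OrbitSpace A) where
  smul t := Quotient.map (sa := orbitSetoid A) (sb := orbitSetoid A) (rotate (gWeight t)) (by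
    rintro z z' h
    obtain ⟨g, rfl⟩ := (orbitSetoid_iff A z z').1 h
    refine (orbitSetoid_iff A _ _).2 ⟨g, ?_⟩
    rw [rotate_rotate, rotate_rotate, mul_comm])
  one_smul := by
    rintro ⟨z⟩
    refine congrArg (Quotient.mk (orbitSetoid A)) ?_
    ext i j
    refine Fin.cases ?_ (fun k => ?_) j <;> simp [rotate, gWeight]
  mul_smul t u := by
    rintro ⟨z⟩
    refine congrArg (Quotient.mk (orbitSetoid A)) ?_
    rw [rotate_rotate]
    ext i j
    refine Fin.cases ?_ (fun k => ?_) j <;> simp [rotate, gWeight]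

/-- The point `(|z^i_j| ^ 2)` of the product of simplices. -/
def sqAbs {n : Fin m → ℕ} (z : SphereProd n) : SimplexProd n :=
  fun i => ⟨fun j => ‖(z i : EuclideanSpace ℂ (Fin (n i + 1))) j‖ ^ 2, fun _ => by positivity, by
    have h := (z i).2
    rw [mem_sphere_zero_iff_norm] at h
    rw [← EuclideanSpace.norm_sq_eq, h, one_pow]⟩

/-- The projection `M(A) → ∏ Δ^(n i)`, `[z] ↦ (|z^i_j| ^ 2)`. -/
def OrbitSpace.proj {n : Fin m → ℕ} (A : VectorMatrix n) : OrbitSpace A → SimplexProd n :=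
  Quotient.lift (s := orbitSetoid A) sqAbs (by
    rintro z z' h
    obtain ⟨g, rfl⟩ := (orbitSetoid_iff A z z').1 h
    funext i
    apply Subtype.ext
    funext j
    simp [sqAbs, rotate, Circle.norm_coe])

end Quasitoric

end

/-!
Write rotations of the coordinates `z^i_j` of the product of spheres as families
`w : ∀ i, Fin (n i + 1) → Circle`. Both `K` and the residual torus consist of rotations, and every
rotation is uniquely a product of one of each.

A vertex of the product of simplices is a choice `v` of one coordinate in each factor. The weights
of `K` on the coordinates `z^i_{v i}` form an integer matrix, `vertexMatrix A v`, whose columns with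
`v i = 0` are unit vectors. Hence its determinant is a principal minor of the vector matrix
(`isUnit_det_vertexMatrix`), so the matrix is invertible over `ℤ` and an element of `K` is
determined by the phases it produces on the coordinates `z^i_{v i}`, which can be prescribed arbitrarily
(`solve`). At every point of `X` some such choice of coordinates is nonzero, which gives freeness.
It also gives charts: over the open set where these coordinates do not vanish, each orbit of `K`
contains exactly one point at which they are all positive, and dividing the other coordinates of
this point by them yields a bijection with `ℂ ^ n` (`affineCoords`, `vertexChart`). Affine
coordinates extend to a smooth function on an open set of the ambient vector space and have the
smooth section `affinePoint` followed by normalization. Thus the changes of charts are smooth, the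
quotient map is smooth, and it has a smooth local section through each point, so it is a submersion.
In a chart the residual torus acts diagonally by characters, and it acts faithfully
(`orbitCoords_smul`, `vertexRep_injective`).

The isotropy group of `[z]` is the projection to the residual torus of the group of rotations fixing
`z`, that is, of the rotations of the vanishing coordinates, and freeness of `K` makes this
projection injective (`nonempty_stabilizer_equiv`). For a point with only `z^i_j = 0`, this is a
circle, with exponents a unit vector for `j ≥ 1` and minus the `i`-th row of `A` for `j = 0`
(`torusPart_mulSingle`). Up to a sign for `j = 0`, these are the vectors of the characteristic
function. That unit vectors form a basis of `Hom(S^1, (S^1)^n)` amounts to the fact that the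
continuous endomorphisms of the circle are the powers (`exists_zpow_of_continuousMonoidHom`), which
is proved with Fourier series.
-/

noncomputable section

namespace Quasitoric

variable {m : ℕ}

/-! ### Weights of the torus action and vertices of the polytope -/

/-- The exponent of `g l` in the number by which `g ∈ (S^1)^m` multiplies the coordinate `z^i_j`. -/
def weightExp {n : Fin m → ℕ} (A : VectorMatrix n) (l i : Fin m) : Fin (n i + 1) → ℤ :=
  Fin.cases (if l = i then 1 else 0) fun k => A l i k

theorem kWeight_eq_prod {n : Fin m → ℕ} (A : VectorMatrix n) (g : Fin m → Circle) (i : Fin m)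
    (j : Fin (n i + 1)) : kWeight A g i j = ∏ l, g l ^ weightExp A l i j := by
  refine Fin.cases ?_ (fun k => ?_) j
  · simp [kWeight, weightExp, pow_ite]
  · simp [kWeight, weightExp]

@[simp] theorem kWeight_one {n : Fin m → ℕ} (A : VectorMatrix n) : kWeight A 1 = 1 := by
  ext i j
  simp [kWeight_eq_prod]

theorem kWeight_mul {n : Fin m → ℕ} (A : VectorMatrix n) (g h : Fin m → Circle) :
    kWeight A (g * h) = kWeight A g * kWeight A h := by
  funext i j
  simp [kWeight_eq_prod, mul_zpow, Finset.prod_mul_distrib]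

theorem kWeight_inv {n : Fin m → ℕ} (A : VectorMatrix n) (g : Fin m → Circle) :
    kWeight A g⁻¹ = (kWeight A g)⁻¹ := by
  funext i j
  simp [kWeight_eq_prod]

theorem gWeight_mul {n : Fin m → ℕ} (t u : Torus n) :
    gWeight (t * u) = gWeight t * gWeight u := by
  funext i j
  refine Fin.cases ?_ (fun k => ?_) j <;> simp [gWeight]

@[simp] theorem gWeight_one {n : Fin m → ℕ} : gWeight (1 : Torus n) = 1 := by
  funext i j
  refine Fin.cases ?_ (fun k => ?_) j <;> simp [gWeight]

@[simp] theorem gWeight_zero {n : Fin m → ℕ} (t : Torus n) (i : Fin m) : gWeight t i 0 = 1 := rfl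

@[simp] theorem gWeight_succ {n : Fin m → ℕ} (t : Torus n) (i : Fin m) (k : Fin (n i)) :
    gWeight t i k.succ = t ⟨i, k⟩ := rfl

@[simp] theorem kWeight_zero {n : Fin m → ℕ} (A : VectorMatrix n) (g : Fin m → Circle)
    (i : Fin m) : kWeight A g i 0 = g i := rfl

/-- The exponents of the coordinates `z^i_{v i}`, where `v` is a choice of one coordinate in each
factor. Such a choice is the same as a vertex of the product of simplices. -/
def vertexMatrix {n : Fin m → ℕ} (A : VectorMatrix n) (v : ∀ i, Fin (n i + 1)) :
    Matrix (Fin m) (Fin m) ℤ :=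
  Matrix.of fun l i => weightExp A l i (v i)

/-- The columns with `v i = 0` are unit vectors, so the determinant is the principal minor on the
other indices. -/
theorem isUnit_det_vertexMatrix {n : Fin m → ℕ} (hn : ∀ i, 1 ≤ n i) {A : VectorMatrix n}
    (hA : A.UnimodularMinors) (v : ∀ i, Fin (n i + 1)) : IsUnit (vertexMatrix A v).det := by
  -- the value of `k` where `v i = 0` is irrelevant; its existence uses `1 ≤ n i`
  have hk : ∀ i, ∃ k : Fin (n i), v i ≠ 0 → k.succ = v i := fun i => by
    by_cases h : v i = 0
    · exact ⟨⟨0, hn i⟩, fun h' => absurd h h'⟩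
    · exact ⟨(v i).pred h, fun _ => Fin.succ_pred _ _⟩
  choose k hk using hk
  let S : Finset (Fin m) := {i | v i ≠ 0}
  have hzero : ∀ l i, v i = 0 → vertexMatrix A v l i = if l = i then 1 else 0 := by
    intro l i h
    simp [vertexMatrix, weightExp, h]
  rw [Matrix.twoBlockTriangular_det' (vertexMatrix A v) (· ∈ S)]
  · have h1 : Matrix.toSquareBlockProp (vertexMatrix A v) (· ∉ S) = 1 := by
      ext a b
      have hb : v b = 0 := by simpa [S] using b.2
      rw [Matrix.toSquareBlockProp_def, Matrix.of_apply, hzero _ _ hb, Matrix.one_apply]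
      simp only [Subtype.ext_iff]
    have h2 : Matrix.toSquareBlockProp (vertexMatrix A v) (· ∈ S) =
        (A.select k).submatrix (Subtype.val : S → Fin m) (Subtype.val : S → Fin m) := by
      ext a b
      have hb : v b ≠ 0 := (Finset.mem_filter.1 b.2).2
      rw [Matrix.toSquareBlockProp_def, Matrix.of_apply]
      simp [vertexMatrix, VectorMatrix.select, weightExp, ← hk b hb]
    rw [h1, h2, Matrix.det_one, mul_one]
    convert Int.isUnit_iff.2 (hA k S)
  · intro l hl i hi
    rw [hzero l i (by simpa [S] using hi), if_neg]
    rintro rfl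
    exact hi hl

/-- The endomorphism `g ↦ (∏ l, g l ^ B l i)_i` of `(S^1)^m` given by an integer matrix. -/
def torusMap (B : Matrix (Fin m) (Fin m) ℤ) (g : Fin m → Circle) : Fin m → Circle :=
  fun i => ∏ l, g l ^ B l i

theorem prod_zpow_eq_zpow_sum {G ι : Type*} [CommGroup G] (g : G) (s : Finset ι) (a : ι → ℤ) :
    ∏ j ∈ s, g ^ a j = g ^ ∑ j ∈ s, a j := by
  induction s using Finset.cons_induction with
  | empty => simp
  | cons j s hj ih => rw [Finset.prod_cons, Finset.sum_cons, zpow_add, ih]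

theorem torusMap_torusMap (B C : Matrix (Fin m) (Fin m) ℤ) (g : Fin m → Circle) :
    torusMap C (torusMap B g) = torusMap (B * C) g := by
  funext i
  simp only [torusMap, Matrix.mul_apply, ← Finset.prod_zpow, ← zpow_mul]
  rw [Finset.prod_comm]
  exact Finset.prod_congr rfl fun l _ => prod_zpow_eq_zpow_sum (g l) _ _

theorem torusMap_one_matrix (g : Fin m → Circle) : torusMap 1 g = g := by
  funext i
  simp [torusMap, Matrix.one_apply, pow_ite]

theorem torusMap_mul (B : Matrix (Fin m) (Fin m) ℤ) (g h : Fin m → Circle) :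
    torusMap B (g * h) = torusMap B g * torusMap B h := by
  funext i
  simp [torusMap, mul_zpow, Finset.prod_mul_distrib]

/-- The element of `(S^1)^m` that multiplies the coordinates `z^i_{v i}` by prescribed numbers. -/
def solve {n : Fin m → ℕ} (A : VectorMatrix n) (v : ∀ i, Fin (n i + 1)) (p : Fin m → Circle) :
    Fin m → Circle :=
  torusMap (vertexMatrix A v)⁻¹ p

theorem torusMap_vertexMatrix {n : Fin m → ℕ} (A : VectorMatrix n) (v : ∀ i, Fin (n i + 1))
    (g : Fin m → Circle) :
    torusMap (vertexMatrix A v) g = fun i => kWeight A g i (v i) := by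
  funext i
  simp [kWeight_eq_prod, torusMap, vertexMatrix]

theorem solve_mul {n : Fin m → ℕ} (A : VectorMatrix n) (v : ∀ i, Fin (n i + 1))
    (p q : Fin m → Circle) : solve A v (p * q) = solve A v p * solve A v q :=
  torusMap_mul _ _ _

@[simp] theorem solve_one {n : Fin m → ℕ} (A : VectorMatrix n) (v : ∀ i, Fin (n i + 1)) :
    solve A v 1 = 1 := by
  funext i
  simp [solve, torusMap]

theorem kWeight_solve {n : Fin m → ℕ} {A : VectorMatrix n} {v : ∀ i, Fin (n i + 1)}
    (hv : IsUnit (vertexMatrix A v).det) (p : Fin m → Circle) (i : Fin m) :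
    kWeight A (solve A v p) i (v i) = p i := by
  have h := torusMap_vertexMatrix A v (solve A v p)
  rw [solve, torusMap_torusMap, Matrix.nonsing_inv_mul _ hv, torusMap_one_matrix] at h
  exact (congrFun h i).symm

theorem solve_kWeight {n : Fin m → ℕ} {A : VectorMatrix n} {v : ∀ i, Fin (n i + 1)}
    (hv : IsUnit (vertexMatrix A v).det) (g : Fin m → Circle) :
    solve A v (fun i => kWeight A g i (v i)) = g := by
  rw [solve, ← torusMap_vertexMatrix, torusMap_torusMap, Matrix.mul_nonsing_inv _ hv,
    torusMap_one_matrix]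

/-! ### Coordinates of points of the product of spheres -/

/-- The complex coordinates `z^i_j` of a point of the product of spheres. -/
def coords {n : Fin m → ℕ} (z : SphereProd n) (i : Fin m) (j : Fin (n i + 1)) : ℂ :=
  (z i : EuclideanSpace ℂ (Fin (n i + 1))) j

theorem coords_injective {n : Fin m → ℕ} : Function.Injective (coords (n := n)) := by
  intro z z' h
  funext i
  apply Subtype.ext
  ext j
  exact congrFun (congrFun h i) j

@[simp] theorem coords_rotate {n : Fin m → ℕ} (w : ∀ i, Fin (n i + 1) → Circle) (z : SphereProd n)
    (i : Fin m) (j : Fin (n i + 1)) : coords (rotate w z) i j = w i j * coords z i j := rfl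

theorem norm_toLp_coords {n : Fin m → ℕ} (z : SphereProd n) (i : Fin m) :
    ‖WithLp.toLp 2 (coords z i)‖ = 1 := by
  have h := (z i).2
  rwa [mem_sphere_zero_iff_norm] at h

theorem exists_coords_ne_zero {n : Fin m → ℕ} (z : SphereProd n) :
    ∃ v : ∀ i, Fin (n i + 1), ∀ i, coords z i (v i) ≠ 0 := by
  have h : ∀ i, ∃ j, coords z i j ≠ 0 := fun i => by
    by_contra! h0
    have h1 := norm_toLp_coords z i
    rw [show coords z i = 0 from funext h0] at h1
    simp at h1
  exact ⟨fun i => (h i).choose, fun i => (h i).choose_spec⟩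

theorem rotate_one {n : Fin m → ℕ} (z : SphereProd n) : rotate 1 z = z :=
  coords_injective (by funext i j; simp)

/-- The point of the product of spheres obtained from nonzero vectors `y i` by normalization. -/
def normalized {n : Fin m → ℕ} (y : ∀ i, Fin (n i + 1) → ℂ) (hy : ∀ i, y i ≠ 0) : SphereProd n :=
  fun i => ⟨(‖WithLp.toLp 2 (y i)‖⁻¹ : ℝ) • WithLp.toLp 2 (y i), by
    have : ‖WithLp.toLp 2 (y i)‖ ≠ 0 := by simpa using hy i
    rw [mem_sphere_zero_iff_norm, norm_smul, norm_inv, norm_norm, inv_mul_cancel₀ this]⟩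

theorem coords_normalized {n : Fin m → ℕ} (y : ∀ i, Fin (n i + 1) → ℂ) (hy : ∀ i, y i ≠ 0)
    (i : Fin m) (j : Fin (n i + 1)) :
    coords (normalized y hy) i j = ((‖WithLp.toLp 2 (y i)‖⁻¹ : ℝ) : ℂ) * y i j := by
  simp [coords, normalized]

theorem normalized_eq_of_smul {n : Fin m → ℕ} (y : ∀ i, Fin (n i + 1) → ℂ) (hy : ∀ i, y i ≠ 0)
    (z : SphereProd n) (r : Fin m → ℝ) (hr : ∀ i, 0 < r i)
    (h : ∀ i j, y i j = r i * coords z i j) : normalized y hy = z := by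
  apply coords_injective
  funext i j
  have : WithLp.toLp 2 (y i) = r i • WithLp.toLp 2 (coords z i) := by
    ext j
    simpa using h i j
  rw [coords_normalized, this, norm_smul, norm_toLp_coords, h, Real.norm_of_nonneg (hr i).le,
    mul_one, ← mul_assoc, ← Complex.ofReal_mul, inv_mul_cancel₀ (hr i).ne', Complex.ofReal_one,
    one_mul]

/-- The phase `z / |z|` of a complex number, with value `1` at `0`. -/
def phase (z : ℂ) : Circle := Circle.exp z.arg

theorem norm_mul_phase (z : ℂ) : (‖z‖ : ℂ) * phase z = z := by
  simp [phase, Complex.norm_mul_exp_arg_mul_I]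

theorem coe_phase {z : ℂ} (hz : z ≠ 0) : (phase z : ℂ) = z / ‖z‖ := by
  rw [eq_div_iff (by simpa using hz), mul_comm, norm_mul_phase]

theorem phase_circle_mul (c : Circle) {z : ℂ} (hz : z ≠ 0) : phase (c * z) = c * phase z := by
  apply Circle.ext
  rw [coe_phase (mul_ne_zero c.coe_ne_zero hz), Circle.coe_mul, coe_phase hz, norm_mul,
    Circle.norm_coe, one_mul, mul_div_assoc]

theorem phase_ofReal_mul {r : ℝ} (hr : 0 < r) (z : ℂ) : phase (r * z) = phase z := by
  rw [phase, phase, Complex.arg_real_mul _ hr]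

@[simp] theorem phase_one : phase 1 = 1 := by simp [phase]

/-- Two points with the same absolute values of the coordinates differ by a rotation. -/
theorem exists_rotate_of_sqAbs_eq {n : Fin m → ℕ} {z z' : SphereProd n} (h : sqAbs z = sqAbs z') :
    ∃ w, rotate w z = z' := by
  refine ⟨fun i j => phase (coords z' i j) * (phase (coords z i j))⁻¹,
    coords_injective (funext fun i => funext fun j => ?_)⟩
  have hij : ‖coords z i j‖ ^ 2 = ‖coords z' i j‖ ^ 2 :=
    congrFun (congrArg Subtype.val (congrFun h i)) j
  have hn : ‖coords z i j‖ = ‖coords z' i j‖ :=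
    (sq_eq_sq₀ (norm_nonneg _) (norm_nonneg _)).1 hij
  have h1 := norm_mul_phase (coords z i j)
  have h2 := norm_mul_phase (coords z' i j)
  have h3 := (phase (coords z i j)).coe_ne_zero
  rw [← hn] at h2
  rw [coords_rotate, Circle.coe_mul, Circle.coe_inv]
  calc (phase (coords z' i j) * (phase (coords z i j) : ℂ)⁻¹ : ℂ) * coords z i j
      = phase (coords z' i j) * (phase (coords z i j) : ℂ)⁻¹ *
        (‖coords z i j‖ * phase (coords z i j)) := by rw [h1]
    _ = ‖coords z i j‖ * phase (coords z' i j) := by field_simp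
    _ = coords z' i j := h2

/-! ### The affine coordinates at a vertex -/

/-- The rotation by which `w` acts on the affine coordinates at `v`: it differs from `w` by the
action of `K` and fixes the coordinates `z^i_{v i}`. The value at `(i, v i)` is `1`, so only the
values at the other coordinates matter. -/
def residual {n : Fin m → ℕ} (A : VectorMatrix n) (v : ∀ i, Fin (n i + 1))
    (w : ∀ i, Fin (n i + 1) → Circle) : ∀ i, Fin (n i + 1) → Circle :=
  w * kWeight A (solve A v fun l => w l (v l))⁻¹

/-- The affine coordinates at the vertex `v` of a point with `z^i_{v i} ≠ 0`: in the `K`-orbit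
there is a unique point with `z^i_{v i} > 0` for all `i`, and the other coordinates of this point
are divided by these positive numbers. -/
def affineCoords {n : Fin m → ℕ} (A : VectorMatrix n) (v : ∀ i, Fin (n i + 1))
    (y : ∀ i, Fin (n i + 1) → ℂ) : CoordIdx n → ℂ :=
  fun c => kWeight A (solve A v fun l => phase (y l (v l)))⁻¹ c.1 ((v c.1).succAbove c.2) *
    y c.1 ((v c.1).succAbove c.2) / ‖y c.1 (v c.1)‖

/-- The point whose `v i`-th coordinates are `1` and whose other coordinates are given. -/
def affinePoint {n : Fin m → ℕ} (v : ∀ i, Fin (n i + 1)) (u : CoordIdx n → ℂ) :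
    ∀ i, Fin (n i + 1) → ℂ :=
  fun i => (v i).insertNth (α := fun _ => ℂ) 1 fun k => u ⟨i, k⟩

@[simp] theorem affinePoint_same {n : Fin m → ℕ} (v : ∀ i, Fin (n i + 1)) (u : CoordIdx n → ℂ)
    (i : Fin m) : affinePoint v u i (v i) = 1 := by
  simp [affinePoint]

@[simp] theorem affinePoint_succAbove {n : Fin m → ℕ} (v : ∀ i, Fin (n i + 1))
    (u : CoordIdx n → ℂ) (i : Fin m) (k : Fin (n i)) :
    affinePoint v u i ((v i).succAbove k) = u ⟨i, k⟩ := by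
  simp [affinePoint]

theorem affinePoint_ne_zero {n : Fin m → ℕ} (v : ∀ i, Fin (n i + 1)) (u : CoordIdx n → ℂ)
    (i : Fin m) : affinePoint v u i ≠ 0 := fun h => by
  have := affinePoint_same v u i
  rw [h] at this
  simp at this

theorem affineCoords_affinePoint {n : Fin m → ℕ} (A : VectorMatrix n) (v : ∀ i, Fin (n i + 1))
    (u : CoordIdx n → ℂ) : affineCoords A v (affinePoint v u) = u := by
  funext c
  have : solve A v (fun _ => 1) = 1 := solve_one A v
  simp [affineCoords, this]

theorem affineCoords_smul {n : Fin m → ℕ} (A : VectorMatrix n) (v : ∀ i, Fin (n i + 1))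
    (y : ∀ i, Fin (n i + 1) → ℂ) (r : Fin m → ℝ) (hr : ∀ i, 0 < r i) :
    affineCoords A v (fun i j => r i * y i j) = affineCoords A v y := by
  funext c
  have h : (r c.1 : ℂ) ≠ 0 := by exact_mod_cast (hr c.1).ne'
  simp only [affineCoords, phase_ofReal_mul (hr _), norm_mul, Complex.norm_real,
    Real.norm_of_nonneg (hr _).le, Complex.ofReal_mul]
  rw [mul_left_comm, mul_div_mul_left _ _ h]

theorem affineCoords_rotate {n : Fin m → ℕ} (A : VectorMatrix n) (v : ∀ i, Fin (n i + 1))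
    (w : ∀ i, Fin (n i + 1) → Circle) (y : ∀ i, Fin (n i + 1) → ℂ) (hy : ∀ i, y i (v i) ≠ 0)
    (c : CoordIdx n) :
    affineCoords A v (fun i j => w i j * y i j) c =
      residual A v w c.1 ((v c.1).succAbove c.2) * affineCoords A v y c := by
  have h : (fun l => phase (w l (v l) * y l (v l))) =
      (fun l => w l (v l)) * fun l => phase (y l (v l)) := by
    funext l
    exact phase_circle_mul _ (hy l)
  simp only [affineCoords, residual, h, solve_mul, mul_inv, kWeight_mul, Pi.mul_apply,
    Circle.coe_mul, norm_mul, Circle.norm_coe, one_mul]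
  ring

theorem residual_kWeight {n : Fin m → ℕ} {A : VectorMatrix n} {v : ∀ i, Fin (n i + 1)}
    (hv : IsUnit (vertexMatrix A v).det) (g : Fin m → Circle) :
    residual A v (kWeight A g) = 1 := by
  rw [residual, solve_kWeight hv, kWeight_inv, mul_inv_cancel]

theorem residual_mul {n : Fin m → ℕ} (A : VectorMatrix n) (v : ∀ i, Fin (n i + 1))
    (w w' : ∀ i, Fin (n i + 1) → Circle) :
    residual A v (w * w') = residual A v w * residual A v w' := by
  have h : (fun l => (w * w') l (v l)) = (fun l => w l (v l)) * fun l => w' l (v l) := rfl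
  rw [residual, h, solve_mul, mul_inv, kWeight_mul, mul_mul_mul_comm]
  rfl

theorem residual_vertex {n : Fin m → ℕ} {A : VectorMatrix n} {v : ∀ i, Fin (n i + 1)}
    (hv : IsUnit (vertexMatrix A v).det) (w : ∀ i, Fin (n i + 1) → Circle) (i : Fin m) :
    residual A v w i (v i) = 1 := by
  simp [residual, kWeight_inv, kWeight_solve hv]

/-- The residual torus acts faithfully on the affine coordinates: a rotation that acts trivially on
them is given by an element of `K`, and this element is trivial because the residual torus fixes
the coordinates `z^i_0`. -/
theorem eq_one_of_residual_gWeight {n : Fin m → ℕ} {A : VectorMatrix n}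
    {v : ∀ i, Fin (n i + 1)} (hv : IsUnit (vertexMatrix A v).det) {t : Torus n}
    (h : ∀ c : CoordIdx n, residual A v (gWeight t) c.1 ((v c.1).succAbove c.2) = 1) : t = 1 := by
  have h1 : residual A v (gWeight t) = 1 := by
    funext i j
    rcases Fin.eq_self_or_eq_succAbove (v i) j with rfl | ⟨k, rfl⟩
    · exact residual_vertex hv _ _
    · exact h ⟨i, k⟩
  rw [residual, kWeight_inv, mul_inv_eq_one] at h1
  have h2 : solve A v (fun l => gWeight t l (v l)) = 1 := by
    funext i
    simpa using (congrFun (congrFun h1 i) 0).symm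
  rw [h2, kWeight_one] at h1
  funext c
  simpa using congrFun (congrFun h1 c.1) c.2.succ

/-- A point is recovered from its affine coordinates up to the action of `K`. -/
theorem normalized_affineCoords {n : Fin m → ℕ} {A : VectorMatrix n} {v : ∀ i, Fin (n i + 1)}
    (hv : IsUnit (vertexMatrix A v).det) (z : SphereProd n) (hz : ∀ i, coords z i (v i) ≠ 0) :
    normalized (affinePoint v (affineCoords A v (coords z))) (affinePoint_ne_zero v _) =
      rotate (kWeight A (solve A v fun l => phase (coords z l (v l)))⁻¹) z := by
  refine normalized_eq_of_smul _ _ _ (fun i => ‖coords z i (v i)‖⁻¹)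
    (fun i => by simpa using hz i) fun i j => ?_
  rw [coords_rotate]
  rcases Fin.eq_self_or_eq_succAbove (v i) j with rfl | ⟨k, rfl⟩
  · have := hz i
    rw [affinePoint_same, kWeight_inv, Pi.inv_apply, Pi.inv_apply, kWeight_solve hv,
      Circle.coe_inv, coe_phase (hz i), Complex.ofReal_inv]
    have : (‖coords z i (v i)‖ : ℂ) ≠ 0 := by simpa using this
    field_simp
  · rw [affinePoint_succAbove, affineCoords, Complex.ofReal_inv, div_eq_inv_mul]

/-- Freeness of the action of `K`: an element fixing a point with `z^i_{v i} ≠ 0` for all `i` has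
trivial weights at these coordinates. -/
theorem eq_one_of_rotate_kWeight_eq {n : Fin m → ℕ} {A : VectorMatrix n}
    (hA : ∀ v, IsUnit (vertexMatrix A v).det) {g : Fin m → Circle} {z : SphereProd n}
    (h : rotate (kWeight A g) z = z) : g = 1 := by
  obtain ⟨v, hz⟩ := exists_coords_ne_zero z
  have h1 : (fun i => kWeight A g i (v i)) = 1 := by
    funext i
    have := congrFun (congrFun (congrArg coords h) i) (v i)
    rw [coords_rotate] at this
    exact Circle.ext (by simpa using mul_right_cancel₀ (hz i) (this.trans (one_mul _).symm))
  rw [← solve_kWeight (hA v) g, h1, solve_one]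

/-! ### Splitting rotations -/

/-- The component in the residual torus `(S^1)^n` of a rotation, in the decomposition of the group
of all rotations as the product of `K` and `(S^1)^n`. The component in `K` consists of the numbers
`w i 0`, because `(S^1)^n` fixes the coordinates `z^i_0`. -/
def torusPart {n : Fin m → ℕ} (A : VectorMatrix n) (w : ∀ i, Fin (n i + 1) → Circle) : Torus n :=
  fun c => w c.1 c.2.succ * (kWeight A (fun l => w l 0) c.1 c.2.succ)⁻¹

theorem kWeight_mul_gWeight_torusPart {n : Fin m → ℕ} (A : VectorMatrix n)
    (w : ∀ i, Fin (n i + 1) → Circle) :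
    kWeight A (fun l => w l 0) * gWeight (torusPart A w) = w := by
  funext i j
  refine Fin.cases ?_ (fun k => ?_) j <;> simp [torusPart]

theorem torusPart_kWeight_mul_gWeight {n : Fin m → ℕ} (A : VectorMatrix n) (g : Fin m → Circle)
    (t : Torus n) : torusPart A (kWeight A g * gWeight t) = t := by
  funext c
  simp [torusPart]

theorem torusPart_mul {n : Fin m → ℕ} (A : VectorMatrix n)
    (w w' : ∀ i, Fin (n i + 1) → Circle) :
    torusPart A (w * w') = torusPart A w * torusPart A w' := by
  funext c
  change w c.1 c.2.succ * w' c.1 c.2.succ *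
    (kWeight A ((fun l => w l 0) * fun l => w' l 0) c.1 c.2.succ)⁻¹ = _
  rw [kWeight_mul, Pi.mul_apply, Pi.mul_apply, mul_inv, mul_mul_mul_comm]
  rfl

theorem torusPart_smul_mk {n : Fin m → ℕ} (A : VectorMatrix n)
    (w : ∀ i, Fin (n i + 1) → Circle) (z : SphereProd n) :
    torusPart A w • OrbitSpace.mk A z = OrbitSpace.mk A (rotate w z) := by
  symm
  refine Quotient.sound ((orbitSetoid_iff A _ _).2 ⟨fun l => w l 0, ?_⟩)
  rw [rotate_rotate, kWeight_mul_gWeight_torusPart]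

theorem smul_mk {n : Fin m → ℕ} (A : VectorMatrix n) (t : Torus n) (z : SphereProd n) :
    t • OrbitSpace.mk A z = OrbitSpace.mk A (rotate (gWeight t) z) := rfl

theorem mk_eq_iff {n : Fin m → ℕ} (A : VectorMatrix n) (z z' : SphereProd n) :
    OrbitSpace.mk A z = OrbitSpace.mk A z' ↔ ∃ g : Fin m → Circle, rotate (kWeight A g) z' = z :=
  Quotient.eq (r := orbitSetoid A)

theorem mk_surjective {n : Fin m → ℕ} (A : VectorMatrix n) :
    Function.Surjective (OrbitSpace.mk A) :=
  Quotient.mk_surjective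

theorem proj_mk {n : Fin m → ℕ} (A : VectorMatrix n) (z : SphereProd n) :
    OrbitSpace.proj A (OrbitSpace.mk A z) = sqAbs z := rfl

theorem mem_facet_sqAbs {n : Fin m → ℕ} (z : SphereProd n) (f : FacetIdx n) :
    sqAbs z ∈ facet n f ↔ coords z f.1 f.2 = 0 := by
  change ‖coords z f.1 f.2‖ ^ 2 = 0 ↔ _
  simp

/-- The isotropy group of `[z]` is the image of the group of rotations that fix `z`. -/
theorem mem_stabilizer_mk_iff {n : Fin m → ℕ} (A : VectorMatrix n) (z : SphereProd n)
    (t : Torus n) : t ∈ MulAction.stabilizer (Torus n) (OrbitSpace.mk A z) ↔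
      ∃ w, rotate w z = z ∧ torusPart A w = t := by
  rw [MulAction.mem_stabilizer_iff]
  constructor
  · intro h
    rw [smul_mk, eq_comm, mk_eq_iff] at h
    obtain ⟨g, hg⟩ := h
    exact ⟨kWeight A g * gWeight t, by rw [← rotate_rotate, hg],
      torusPart_kWeight_mul_gWeight A g t⟩
  · rintro ⟨w, hw, rfl⟩
    rw [torusPart_smul_mk, hw]

theorem rotate_eq_self_iff {n : Fin m → ℕ} (w : ∀ i, Fin (n i + 1) → Circle) (z : SphereProd n) :
    rotate w z = z ↔ ∀ i j, coords z i j ≠ 0 → w i j = 1 := by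
  rw [← coords_injective.eq_iff]
  simp only [funext_iff, coords_rotate]
  refine forall_congr' fun i => forall_congr' fun j => ?_
  by_cases h : coords z i j = 0
  · simp [h]
  · rw [mul_eq_right₀ h, Circle.coe_eq_one]
    simp [h]

/-! ### Homomorphisms between tori -/

/-- A continuous function on the circle all of whose Fourier coefficients vanish is zero, and
distinct characters are orthogonal; so each character is one of those in the Fourier basis. -/
theorem exists_zpow_of_continuousMonoidHom (χ : Circle →ₜ* Circle) :
    ∃ k : ℤ, ∀ c, χ c = c ^ k := by
  have : Fact (0 < 2 * Real.pi) := ⟨by positivity⟩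
  let e : AddCircle (2 * Real.pi) → Circle := AddCircle.toCircle
  let f : C(AddCircle (2 * Real.pi), ℂ) :=
    ⟨fun x => (χ (e x) : ℂ), by
      have := AddCircle.continuous_toCircle (T := 2 * Real.pi)
      have := χ.continuous_toFun.comp this
      exact continuous_subtype_val.comp this⟩
  have hsurj : Function.Surjective e := fun c =>
    ⟨((c : ℂ).arg : AddCircle (2 * Real.pi)), by
      rw [show e = AddCircle.toCircle from rfl, AddCircle.toCircle_apply_mk,
        div_self (by positivity), one_mul, Circle.exp_arg]⟩
  by_contra! hne
  have hzero : ∀ k, fourierCoeff f k = 0 := by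
    intro k
    obtain ⟨c, hc⟩ := hne k
    obtain ⟨a, rfl⟩ := hsurj c
    let F : AddCircle (2 * Real.pi) → ℂ := fun x => fourier (-k) x • f x
    have hF : ∀ x, F (a + x) = F a * F x := by
      intro x
      simp only [F, f, e, fourier_apply, smul_eq_mul, ContinuousMap.coe_mk, smul_add,
        AddCircle.toCircle_add, map_mul, Circle.coe_mul]
      ring
    have hFa : F a ≠ 1 := by
      intro h
      apply hc
      have : AddCircle.toCircle (-k • a) * χ (e a) = 1 := by
        apply Circle.ext
        simpa [F, f, fourier_apply] using h
      rw [AddCircle.toCircle_zsmul, zpow_neg, inv_mul_eq_one] at this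
      exact this.symm
    have hI := MeasureTheory.integral_add_left_eq_self (μ := AddCircle.haarAddCircle) F a
    simp only [hF, MeasureTheory.integral_const_mul] at hI
    change ∫ x, F x ∂AddCircle.haarAddCircle = 0
    by_contra h0
    exact hFa (mul_right_cancel₀ h0 (hI.trans (one_mul _).symm))
  have hs : Summable (fourierCoeff f) := by
    rw [show fourierCoeff f = 0 from funext hzero]
    exact summable_zero
  have h := (has_pointwise_sum_fourier_series_of_summable hs 0).tsum_eq
  simp only [hzero, zero_smul, tsum_zero] at h
  simp [f, e] at h

theorem eq_of_forall_zpow_eq {k l : ℤ} (h : ∀ c : Circle, c ^ k = c ^ l) : k = l := by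
  by_contra hkl
  have hd : ((k - l : ℤ) : ℝ) ≠ 0 := by exact_mod_cast sub_ne_zero.2 hkl
  have h1 : Circle.exp (Real.pi / (k - l : ℤ)) ^ (k - l) = 1 := by
    rw [zpow_sub, h, mul_inv_cancel]
  rw [← Circle.exp_zsmul, zsmul_eq_mul, mul_div_cancel₀ _ hd, Circle.exp_eq_one] at h1
  obtain ⟨q, hq⟩ := h1
  have h2 : (1 : ℝ) = ((q * 2 : ℤ) : ℝ) := by
    apply mul_right_cancel₀ Real.pi_ne_zero
    push_cast
    linarith
  have h3 : (1 : ℤ) = q * 2 := by exact_mod_cast h2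
  omega

/-- The homomorphism `c ↦ (c ^ a x)_x` from the circle to a torus. -/
def cocharOfExponents {n : Fin m → ℕ} (a : CoordIdx n → ℤ) : Circle →ₜ* Torus n where
  toFun c := fun x => c ^ a x
  map_one' := by funext x; simp
  map_mul' c d := by funext x; simp [mul_zpow]
  continuous_toFun := continuous_pi fun x => continuous_zpow (a x)

/-- `Hom(S^1, (S^1)^n)` is the free abelian group of vectors of exponents. -/
def cocharEquiv (n : Fin m → ℕ) : (CoordIdx n → ℤ) ≃+ Cochar n :=
  AddEquiv.ofBijective
    (AddMonoidHom.mk' (fun a => Additive.ofMul (cocharOfExponents a)) fun a b => by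
      apply Additive.toMul.injective
      refine ContinuousMonoidHom.ext fun c => funext fun x => ?_
      exact zpow_add c (a x) (b x))
    ⟨fun a b h => by
      have h1 : cocharOfExponents a = cocharOfExponents b := h
      funext x
      exact eq_of_forall_zpow_eq fun c => congrFun (DFunLike.congr_fun h1 c) x,
    fun v => by
      let p : CoordIdx n → Circle →ₜ* Circle := fun x =>
        { toFun := fun c => v.toMul c x
          map_one' := by simp
          map_mul' := fun c d => by simp
          continuous_toFun := (continuous_apply x).comp v.toMul.continuous_toFun }
      choose a ha using fun x => exists_zpow_of_continuousMonoidHom (p x)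
      refine ⟨a, Additive.toMul.injective ?_⟩
      ext c x
      exact congrArg _ (ha x c).symm⟩

theorem toMul_cocharEquiv_apply {n : Fin m → ℕ} (a : CoordIdx n → ℤ) (c : Circle)
    (x : CoordIdx n) : (cocharEquiv n a).toMul c x = c ^ a x := rfl

/-- The basis of `Hom(S^1, (S^1)^n)` formed by the inclusions of the coordinate circles. -/
def cocharBasis (n : Fin m → ℕ) : Module.Basis (CoordIdx n) ℤ (Cochar n) :=
  Module.Basis.ofEquivFun (cocharEquiv n).symm.toIntLinearEquiv

theorem cocharBasis_apply {n : Fin m → ℕ} (x : CoordIdx n) :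
    cocharBasis n x = cocharEquiv n (Pi.single x 1) := by
  simp [cocharBasis]

theorem cocharBasis_repr {n : Fin m → ℕ} (a : CoordIdx n → ℤ) (x : CoordIdx n) :
    (cocharBasis n).repr (cocharEquiv n a) x = a x := by
  simp [cocharBasis]

/-- A vector with a component `±1` is primitive. -/
theorem isPrimitiveVector_cocharEquiv {n : Fin m → ℕ} {a : CoordIdx n → ℤ} {x : CoordIdx n}
    (h : IsUnit (a x)) : IsPrimitiveVector (cocharEquiv n a) := by
  intro d w hw
  obtain ⟨b, rfl⟩ := (cocharEquiv n).surjective w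
  rw [← map_zsmul, (cocharEquiv n).injective.eq_iff] at hw
  rw [hw, Pi.smul_apply, smul_eq_mul] at h
  exact isUnit_of_mul_isUnit_left h

/-! ### Smooth maps into and out of products of manifolds -/

section PiManifold

variable {ι : Type*} [Fintype ι] {E : ι → Type*} [∀ i, NormedAddCommGroup (E i)]
  [∀ i, NormedSpace ℝ (E i)] {H : ι → Type*} [∀ i, TopologicalSpace (H i)]
  (I : ∀ i, ModelWithCorners ℝ (E i) (H i)) (N : ι → Type*) [∀ i, TopologicalSpace (N i)]
  [∀ i, ChartedSpace (H i) (N i)]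

/-- The projections of a product of manifolds are smooth. -/
theorem contMDiff_apply_pi [∀ i, IsManifold (I i) ∞ (N i)] (i : ι) :
    ContMDiff (ModelWithCorners.pi I) (I i) ∞ (fun f : ∀ i, N i => f i) := by
  intro f
  rw [contMDiffAt_iff]
  refine ⟨(continuous_apply i).continuousAt, ?_⟩
  -- in the product chart the projection is a linear projection
  have h : ContDiffWithinAt ℝ ∞ (fun y : ∀ i, E i => y i) (Set.range (ModelWithCorners.pi I))
      (extChartAt (ModelWithCorners.pi I) f f) :=
    (ContinuousLinearMap.proj (R := ℝ) (φ := E) i).contDiff.contDiffWithinAt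
  refine h.congr_of_eventuallyEq_of_mem ?_ (Set.mem_range_self _)
  filter_upwards [extChartAt_target_mem_nhdsWithin (I := ModelWithCorners.pi I) f] with y hy
  exact congrFun ((extChartAt (ModelWithCorners.pi I) f).right_inv hy) i

variable {I N} {E' : Type*} [NormedAddCommGroup E'] [NormedSpace ℝ E'] {H' : Type*}
  [TopologicalSpace H'] {J : ModelWithCorners ℝ E' H'} {N' : Type*} [TopologicalSpace N']
  [ChartedSpace H' N']

/-- A map into a product of manifolds is smooth if its components are. -/
theorem contMDiff_of_forall_apply {f : N' → ∀ i, N i}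
    (h : ∀ i, ContMDiff J (I i) ∞ fun x => f x i) : ContMDiff J (ModelWithCorners.pi I) ∞ f := by
  intro x
  rw [contMDiffAt_iff]
  refine ⟨(continuous_pi fun i => (h i).continuous).continuousAt, ?_⟩
  rw [contDiffWithinAt_pi]
  exact fun i => (contMDiffAt_iff.1 (h i x)).2

end PiManifold

/-! ### Smoothness of circle-valued maps and of the affine coordinates -/

section CircleValued

variable {E' : Type*} [NormedAddCommGroup E'] [NormedSpace ℝ E'] {H' : Type*}
  [TopologicalSpace H'] {J : ModelWithCorners ℝ E' H'} {N' : Type*} [TopologicalSpace N']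
  [ChartedSpace H' N'] {x : N'}

theorem contMDiff_coe_circle : ContMDiff (𝓡 1) 𝓘(ℝ, ℂ) ∞ (fun c : Circle => (c : ℂ)) :=
  haveI := finrank_real_complex_fact'
  contMDiff_coe_sphere (E := ℂ)

theorem contMDiffAt_coe_mul {f g : N' → ℂ} (hf : ContMDiffAt J 𝓘(ℝ, ℂ) ∞ f x)
    (hg : ContMDiffAt J 𝓘(ℝ, ℂ) ∞ g x) : ContMDiffAt J 𝓘(ℝ, ℂ) ∞ (fun y => f y * g y) x :=
  (contDiff_mul (𝕜 := ℝ) (𝔸 := ℂ)).contDiffAt.comp_contMDiffAt (hf.prodMk_space hg)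

theorem contMDiffAt_coe_circle_inv {f : N' → Circle}
    (hf : ContMDiffAt J 𝓘(ℝ, ℂ) ∞ (fun y => (f y : ℂ)) x) :
    ContMDiffAt J 𝓘(ℝ, ℂ) ∞ (fun y => ((f y)⁻¹ : Circle).val) x := by
  simp only [Circle.coe_inv_eq_conj]
  exact Complex.conjCLE.contDiff.contDiffAt.comp_contMDiffAt hf

theorem contMDiffAt_coe_circle_zpow {f : N' → Circle}
    (hf : ContMDiffAt J 𝓘(ℝ, ℂ) ∞ (fun y => (f y : ℂ)) x) (k : ℤ) :
    ContMDiffAt J 𝓘(ℝ, ℂ) ∞ (fun y => (f y ^ k : Circle).val) x := by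
  have hpow : ∀ (q : ℕ) {g : N' → Circle}, ContMDiffAt J 𝓘(ℝ, ℂ) ∞ (fun y => (g y : ℂ)) x →
      ContMDiffAt J 𝓘(ℝ, ℂ) ∞ (fun y => (g y ^ q : Circle).val) x := by
    intro q g hg
    simp only [Circle.coe_pow]
    exact (contDiff_id.pow q).contDiffAt.comp_contMDiffAt hg
  cases k with
  | ofNat q => simpa using hpow q hf
  | negSucc q =>
    simp only [zpow_negSucc]
    exact contMDiffAt_coe_circle_inv (hpow (q + 1) hf)

theorem contMDiffAt_coe_circle_prod {ι : Type*} (s : Finset ι) {f : ι → N' → Circle}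
    (hf : ∀ i, ContMDiffAt J 𝓘(ℝ, ℂ) ∞ (fun y => (f i y : ℂ)) x) :
    ContMDiffAt J 𝓘(ℝ, ℂ) ∞ (fun y => (∏ i ∈ s, f i y : Circle).val) x := by
  induction s using Finset.cons_induction with
  | empty => simpa using contMDiffAt_const
  | cons i s hi ih =>
    simp only [Finset.prod_cons, Circle.coe_mul]
    exact contMDiffAt_coe_mul (hf i) ih

theorem contMDiffAt_coe_torusMap (B : Matrix (Fin m) (Fin m) ℤ) {p : N' → Fin m → Circle}
    (hp : ∀ i, ContMDiffAt J 𝓘(ℝ, ℂ) ∞ (fun y => (p y i : ℂ)) x) (i : Fin m) :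
    ContMDiffAt J 𝓘(ℝ, ℂ) ∞ (fun y => (torusMap B (p y) i : ℂ)) x :=
  contMDiffAt_coe_circle_prod _ fun l => contMDiffAt_coe_circle_zpow (hp l) _

theorem contMDiffAt_coe_kWeight_solve {n : Fin m → ℕ} (A : VectorMatrix n)
    (v : ∀ i, Fin (n i + 1)) {p : N' → Fin m → Circle}
    (hp : ∀ i, ContMDiffAt J 𝓘(ℝ, ℂ) ∞ (fun y => (p y i : ℂ)) x) (i : Fin m)
    (j : Fin (n i + 1)) :
    ContMDiffAt J 𝓘(ℝ, ℂ) ∞ (fun y => (kWeight A (solve A v (p y))⁻¹ i j : ℂ)) x := by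
  simp only [kWeight_eq_prod]
  exact contMDiffAt_coe_circle_prod _ fun l => contMDiffAt_coe_circle_zpow
    (contMDiffAt_coe_circle_inv (contMDiffAt_coe_torusMap _ hp l)) _

theorem contMDiffAt_coe_residual {n : Fin m → ℕ} (A : VectorMatrix n)
    (v : ∀ i, Fin (n i + 1)) {w : N' → ∀ i, Fin (n i + 1) → Circle}
    (hw : ∀ i j, ContMDiffAt J 𝓘(ℝ, ℂ) ∞ (fun y => (w y i j : ℂ)) x) (i : Fin m)
    (j : Fin (n i + 1)) :
    ContMDiffAt J 𝓘(ℝ, ℂ) ∞ (fun y => (residual A v (w y) i j : ℂ)) x :=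
  contMDiffAt_coe_mul (hw i j) (contMDiffAt_coe_kWeight_solve A v (fun l => hw l (v l)) i j)

end CircleValued

theorem contDiffAt_phase {z : ℂ} (hz : z ≠ 0) : ContDiffAt ℝ ∞ (fun z => (phase z : ℂ)) z := by
  have h : ContDiffAt ℝ ∞ (fun z : ℂ => (‖z‖⁻¹ : ℝ) • z) z :=
    ((contDiffAt_norm ℝ hz).inv (by simpa using hz)).smul contDiffAt_id
  refine h.congr_of_eventuallyEq ?_
  filter_upwards [isOpen_ne.mem_nhds hz] with y hy
  rw [coe_phase hy, Complex.real_smul, Complex.ofReal_inv, div_eq_inv_mul]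

theorem contDiffAt_affineCoords {n : Fin m → ℕ} (A : VectorMatrix n) (v : ∀ i, Fin (n i + 1))
    {y : ∀ i, Fin (n i + 1) → ℂ} (hy : ∀ i, y i (v i) ≠ 0) :
    ContDiffAt ℝ ∞ (affineCoords A v) y := by
  have hap : ∀ i j, ContDiffAt ℝ ∞ (fun y : ∀ i, Fin (n i + 1) → ℂ => y i j) y := fun i j =>
    (contDiff_pi.1 (contDiff_pi.1 contDiff_id i) j).contDiffAt
  rw [contDiffAt_pi]
  intro c
  have h1 := contMDiffAt_coe_kWeight_solve (J := 𝓘(ℝ, ∀ i, Fin (n i + 1) → ℂ)) (x := y) A v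
    (p := fun y l => phase (y l (v l)))
    (fun i => ((contDiffAt_phase (hy i)).comp y (hap i (v i))).contMDiffAt) c.1
    ((v c.1).succAbove c.2)
  have h2 : ContDiffAt ℝ ∞ (fun y : ∀ i, Fin (n i + 1) → ℂ => (‖y c.1 (v c.1)‖⁻¹ : ℝ)) y :=
    ((hap c.1 (v c.1)).norm ℝ (hy c.1)).inv (by simpa using hy c.1)
  have h3 := h2.smul (h1.contDiffAt.mul (hap c.1 ((v c.1).succAbove c.2)))
  refine h3.congr_of_eventuallyEq (Filter.Eventually.of_forall fun y => ?_)
  simp only [affineCoords, Pi.smul_apply', Complex.real_smul, Complex.ofReal_inv, div_eq_inv_mul]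

theorem contDiff_affinePoint {n : Fin m → ℕ} (v : ∀ i, Fin (n i + 1)) :
    ContDiff ℝ ∞ (affinePoint v) := by
  refine contDiff_pi.2 fun i => contDiff_pi.2 fun j => ?_
  rcases Fin.eq_self_or_eq_succAbove (v i) j with rfl | ⟨k, rfl⟩
  · simpa using contDiff_const
  · simpa using contDiff_apply ℝ ℂ (⟨i, k⟩ : CoordIdx n)

theorem contMDiff_coords {n : Fin m → ℕ} :
    ContMDiff (sphereModel n) 𝓘(ℝ, ∀ i, Fin (n i + 1) → ℂ) ∞ (coords (n := n)) := by
  refine contMDiff_pi_space.2 fun i => ?_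
  have h1 : ContMDiff (sphereModel n) (𝓡 (2 * n i + 1)) ∞ (fun z : SphereProd n => z i) :=
    contMDiff_apply_pi (fun i => 𝓡 (2 * n i + 1))
      (fun i => Metric.sphere (0 : EuclideanSpace ℂ (Fin (n i + 1))) 1) i
  have h2 : ContMDiff (sphereModel n) 𝓘(ℝ, EuclideanSpace ℂ (Fin (n i + 1))) ∞
      (fun z : SphereProd n => (z i : EuclideanSpace ℂ (Fin (n i + 1)))) :=
    contMDiff_coe_sphere.comp h1
  exact ((PiLp.continuousLinearEquiv 2 ℝ fun _ : Fin (n i + 1) => ℂ).contDiff.contMDiff).comp h2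

/-- Smooth families of nonzero vectors give smooth maps to the product of spheres. -/
theorem contMDiff_rotate_normalized {n : Fin m → ℕ} {F : Type*} [NormedAddCommGroup F]
    [NormedSpace ℝ F] {y : F → ∀ i, Fin (n i + 1) → ℂ} (hy : ∀ x i, y x i ≠ 0)
    (hs : ContDiff ℝ ∞ y) (w : ∀ i, Fin (n i + 1) → Circle) :
    ContMDiff 𝓘(ℝ, F) (sphereModel n) ∞ fun x => rotate w (normalized (y x) (hy x)) := by
  refine contMDiff_of_forall_apply fun i => ?_
  have hyi : ContDiff ℝ ∞ fun x => WithLp.toLp 2 (y x i) :=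
    (PiLp.continuousLinearEquiv 2 ℝ fun _ : Fin (n i + 1) => ℂ).symm.contDiff.comp
      (contDiff_pi.1 hs i)
  have h1 : ContDiff ℝ ∞ fun x => (‖WithLp.toLp 2 (y x i)‖⁻¹ : ℝ) • WithLp.toLp 2 (y x i) := by
    have hne : ∀ x, WithLp.toLp 2 (y x i) ≠ 0 := fun x => by simpa using hy x i
    exact ((hyi.norm ℝ hne).inv fun x => norm_ne_zero_iff.2 (hne x)).smul hyi
  have h2 : ContDiff ℝ ∞ fun x => (WithLp.toLp 2 fun j => (w i j : ℂ) *
      ((‖WithLp.toLp 2 (y x i)‖⁻¹ : ℝ) • WithLp.toLp 2 (y x i) :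
        EuclideanSpace ℂ (Fin (n i + 1))) j : EuclideanSpace ℂ (Fin (n i + 1))) := by
    refine (PiLp.continuousLinearEquiv 2 ℝ fun _ : Fin (n i + 1) => ℂ).symm.contDiff.comp ?_
    refine contDiff_pi.2 fun j => contDiff_const.mul ?_
    exact contDiff_pi.1
      ((PiLp.continuousLinearEquiv 2 ℝ fun _ : Fin (n i + 1) => ℂ).contDiff.comp h1) j
  exact h2.contMDiff.codRestrict_sphere fun x =>
    (rotate w (normalized (y x) (hy x)) i).2

/-! ### Topology of the orbit space -/

theorem continuous_coords {n : Fin m → ℕ} : Continuous (coords (n := n)) :=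
  contMDiff_coords.continuous

theorem continuous_rotate {n : Fin m → ℕ} :
    Continuous fun p : (∀ i, Fin (n i + 1) → Circle) × SphereProd n => rotate p.1 p.2 := by
  refine continuous_pi fun i => Continuous.subtype_mk ?_ _
  refine (PiLp.continuous_toLp 2 _).comp (continuous_pi fun j => ?_)
  refine (continuous_subtype_val.comp ?_).mul ?_
  · exact (continuous_apply j).comp ((continuous_apply i).comp continuous_fst)
  · exact (continuous_apply j).comp
      ((continuous_apply i).comp (continuous_coords.comp continuous_snd))

theorem continuous_kWeight {n : Fin m → ℕ} (A : VectorMatrix n) : Continuous (kWeight A) := by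
  refine continuous_pi fun i => continuous_pi fun j => ?_
  simp only [kWeight_eq_prod]
  exact continuous_finsetProd _ fun l _ => (continuous_apply l).zpow _

theorem continuous_sqAbs {n : Fin m → ℕ} : Continuous (sqAbs (n := n)) := by
  refine continuous_pi fun i => Continuous.subtype_mk (continuous_pi fun j => ?_) _
  exact (((continuous_apply j).comp ((continuous_apply i).comp continuous_coords)).norm).pow 2

theorem isOpenQuotientMap_mk {n : Fin m → ℕ} (A : VectorMatrix n) :
    IsOpenQuotientMap (OrbitSpace.mk A) := by
  let _ := kAction A
  have : ContinuousConstSMul (Fin m → Circle) (SphereProd n) :=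
    ⟨fun g => continuous_rotate.comp (continuous_const.prodMk continuous_id)⟩
  exact MulAction.isOpenQuotientMap_quotientMk

theorem continuous_mk {n : Fin m → ℕ} (A : VectorMatrix n) : Continuous (OrbitSpace.mk A) :=
  (isOpenQuotientMap_mk A).continuous

theorem continuous_proj {n : Fin m → ℕ} (A : VectorMatrix n) : Continuous (OrbitSpace.proj A) :=
  (isOpenQuotientMap_mk A).continuous_comp_iff.1 continuous_sqAbs

instance {n : Fin m → ℕ} (A : VectorMatrix n) : CompactSpace (OrbitSpace A) :=
  ⟨by
    rw [← (mk_surjective A).range_eq]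
    exact isCompact_range (continuous_mk A)⟩

instance {n : Fin m → ℕ} (A : VectorMatrix n) : SecondCountableTopology (OrbitSpace A) :=
  (isOpenQuotientMap_mk A).isQuotientMap.secondCountableTopology (isOpenQuotientMap_mk A).isOpenMap

/-- The orbit relation of the compact group `K` is compact, hence closed. -/
instance {n : Fin m → ℕ} (A : VectorMatrix n) : T2Space (OrbitSpace A) := by
  rw [t2Space_iff_of_isOpenQuotientMap (isOpenQuotientMap_mk A)]
  have h : {q : SphereProd n × SphereProd n | OrbitSpace.mk A q.1 = OrbitSpace.mk A q.2} =
      Set.range fun p : (Fin m → Circle) × SphereProd n => (rotate (kWeight A p.1) p.2, p.2) := by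
    ext ⟨z, z'⟩
    simp [mk_eq_iff]
  rw [h]
  refine (isCompact_range ?_).isClosed
  exact (continuous_rotate.comp
    (((continuous_kWeight A).comp continuous_fst).prodMk continuous_snd)).prodMk continuous_snd

/-! ### The charts at the vertices -/

/-- The affine coordinates at the vertex `v` on the orbit space. Outside of `vertexDomain A v` the
value depends on the choice of a representative and has no meaning. -/
def orbitCoords {n : Fin m → ℕ} (A : VectorMatrix n) (v : ∀ i, Fin (n i + 1)) (x : OrbitSpace A) :
    CoordIdx n → ℂ :=
  affineCoords A v (coords (Function.surjInv (mk_surjective A) x))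

/-- The part of the orbit space lying over the faces that contain the vertex `v`; it consists of
the orbits of the points with `z^i_{v i} ≠ 0` for all `i`. -/
def vertexDomain {n : Fin m → ℕ} (A : VectorMatrix n) (v : ∀ i, Fin (n i + 1)) :
    Set (OrbitSpace A) :=
  {x | ∀ i, OrbitSpace.proj A x ∉ facet n ⟨i, v i⟩}

theorem mk_mem_vertexDomain {n : Fin m → ℕ} (A : VectorMatrix n) (v : ∀ i, Fin (n i + 1))
    (z : SphereProd n) : OrbitSpace.mk A z ∈ vertexDomain A v ↔ ∀ i, coords z i (v i) ≠ 0 :=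
  forall_congr' fun i => not_congr (mem_facet_sqAbs z ⟨i, v i⟩)

theorem isClosed_facet {n : Fin m → ℕ} (f : FacetIdx n) : IsClosed (facet n f) :=
  isClosed_eq ((continuous_apply f.2).comp (continuous_subtype_val.comp (continuous_apply f.1)))
    continuous_const

theorem isOpen_vertexDomain {n : Fin m → ℕ} (A : VectorMatrix n) (v : ∀ i, Fin (n i + 1)) :
    IsOpen (vertexDomain A v) := by
  have : vertexDomain A v = ⋂ i, (OrbitSpace.proj A ⁻¹' facet n ⟨i, v i⟩)ᶜ := by
    ext x
    simp [vertexDomain]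
  rw [this]
  exact isOpen_iInter_of_finite fun i =>
    ((isClosed_facet _).preimage (continuous_proj A)).isOpen_compl

theorem exists_mem_vertexDomain {n : Fin m → ℕ} (A : VectorMatrix n) (x : OrbitSpace A) :
    ∃ v, x ∈ vertexDomain A v := by
  obtain ⟨z, rfl⟩ := mk_surjective A x
  obtain ⟨v, hv⟩ := exists_coords_ne_zero z
  exact ⟨v, (mk_mem_vertexDomain A v z).2 hv⟩

theorem orbitCoords_mk {n : Fin m → ℕ} {A : VectorMatrix n} {v : ∀ i, Fin (n i + 1)}
    (hv : IsUnit (vertexMatrix A v).det) {z : SphereProd n} (hz : ∀ i, coords z i (v i) ≠ 0) :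
    orbitCoords A v (OrbitSpace.mk A z) = affineCoords A v (coords z) := by
  obtain ⟨g, hg⟩ := (mk_eq_iff A _ _).1 (Function.surjInv_eq (mk_surjective A) (OrbitSpace.mk A z))
  rw [orbitCoords, ← hg]
  funext c
  exact (affineCoords_rotate A v (kWeight A g) (coords z) hz c).trans
    (by simp [residual_kWeight hv])

/-- The class of the point with given affine coordinates at the vertex `v`. -/
def ofAffineCoords {n : Fin m → ℕ} (A : VectorMatrix n) (v : ∀ i, Fin (n i + 1))
    (u : CoordIdx n → ℂ) : OrbitSpace A :=
  OrbitSpace.mk A (normalized (affinePoint v u) (affinePoint_ne_zero v u))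

theorem coords_normalized_affinePoint_ne_zero {n : Fin m → ℕ} {v v' : ∀ i, Fin (n i + 1)}
    {u : CoordIdx n → ℂ} :
    (∀ i, coords (normalized (affinePoint v u) (affinePoint_ne_zero v u)) i (v' i) ≠ 0) ↔
      ∀ i, affinePoint v u i (v' i) ≠ 0 := by
  refine forall_congr' fun i => not_congr ?_
  have := affinePoint_ne_zero v u i
  simp [coords_normalized, this]

theorem ofAffineCoords_mem_vertexDomain {n : Fin m → ℕ} (A : VectorMatrix n)
    (v : ∀ i, Fin (n i + 1)) (u : CoordIdx n → ℂ) : ofAffineCoords A v u ∈ vertexDomain A v :=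
  (mk_mem_vertexDomain A v _).2 (coords_normalized_affinePoint_ne_zero.2 (by simp))

theorem orbitCoords_ofAffineCoords {n : Fin m → ℕ} {A : VectorMatrix n}
    {v v' : ∀ i, Fin (n i + 1)} (hv' : IsUnit (vertexMatrix A v').det) {u : CoordIdx n → ℂ}
    (hu : ∀ i, affinePoint v u i (v' i) ≠ 0) :
    orbitCoords A v' (ofAffineCoords A v u) = affineCoords A v' (affinePoint v u) := by
  rw [ofAffineCoords, orbitCoords_mk hv' (coords_normalized_affinePoint_ne_zero.2 hu)]
  rw [← affineCoords_smul A v' (affinePoint v u) fun i => ‖WithLp.toLp 2 (affinePoint v u i)‖⁻¹]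
  · congr 1
  · intro i
    simpa using affinePoint_ne_zero v u i

theorem ofAffineCoords_orbitCoords {n : Fin m → ℕ} {A : VectorMatrix n}
    {v : ∀ i, Fin (n i + 1)} (hv : IsUnit (vertexMatrix A v).det) {x : OrbitSpace A}
    (hx : x ∈ vertexDomain A v) : ofAffineCoords A v (orbitCoords A v x) = x := by
  obtain ⟨z, rfl⟩ := mk_surjective A x
  rw [mk_mem_vertexDomain] at hx
  rw [orbitCoords_mk hv hx, ofAffineCoords, normalized_affineCoords hv z hx]
  exact (mk_eq_iff A _ _).2 ⟨_, rfl⟩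

/-- The residual torus acts diagonally on the affine coordinates at `v`. -/
theorem orbitCoords_smul {n : Fin m → ℕ} {A : VectorMatrix n} {v : ∀ i, Fin (n i + 1)}
    (hv : IsUnit (vertexMatrix A v).det) (t : Torus n) {x : OrbitSpace A}
    (hx : x ∈ vertexDomain A v) (c : CoordIdx n) : orbitCoords A v (t • x) c =
      residual A v (gWeight t) c.1 ((v c.1).succAbove c.2) * orbitCoords A v x c := by
  obtain ⟨z, rfl⟩ := mk_surjective A x
  rw [mk_mem_vertexDomain] at hx
  rw [smul_mk, orbitCoords_mk hv hx, orbitCoords_mk hv fun i => ?_]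
  · exact affineCoords_rotate A v (gWeight t) (coords z) hx c
  · simpa using hx i

theorem proj_smul {n : Fin m → ℕ} (A : VectorMatrix n) (t : Torus n) (x : OrbitSpace A) :
    OrbitSpace.proj A (t • x) = OrbitSpace.proj A x := by
  obtain ⟨z, rfl⟩ := mk_surjective A x
  rw [smul_mk, proj_mk, proj_mk]
  funext i
  apply Subtype.ext
  funext j
  change ‖coords (rotate (gWeight t) z) i j‖ ^ 2 = ‖coords z i j‖ ^ 2
  rw [coords_rotate, norm_mul, Circle.norm_coe, one_mul]

theorem smul_mem_vertexDomain {n : Fin m → ℕ} {A : VectorMatrix n} {v : ∀ i, Fin (n i + 1)}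
    (t : Torus n) {x : OrbitSpace A} (hx : x ∈ vertexDomain A v) : t • x ∈ vertexDomain A v := by
  simpa only [vertexDomain, Set.mem_ofPred_eq, proj_smul] using hx

/-- An isomorphism of `ℂ ^ n` with the model space `ℝ ^ (2 n)`. -/
def modelEquiv (n : Fin m → ℕ) : (CoordIdx n → ℂ) ≃L[ℝ] Model n :=
  ContinuousLinearEquiv.ofFinrankEq (by
    rw [Module.finrank_pi_fintype, finrank_euclideanSpace_fin]
    simp [Complex.finrank_real_complex, mul_comm])

theorem contMDiff_normalized_affinePoint {n : Fin m → ℕ} (v : ∀ i, Fin (n i + 1))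
    (w : ∀ i, Fin (n i + 1) → Circle) :
    ContMDiff 𝓘(ℝ, Model n) (sphereModel n) ∞ fun y =>
      rotate w (normalized (affinePoint v ((modelEquiv n).symm y)) (affinePoint_ne_zero v _)) :=
  contMDiff_rotate_normalized (fun _ => affinePoint_ne_zero v _)
    ((contDiff_affinePoint v).comp (modelEquiv n).symm.contDiff) w

/-- The chart at the vertex `v` given by the affine coordinates; it is onto. -/
def vertexChart {n : Fin m → ℕ} (A : VectorMatrix n) (v : ∀ i, Fin (n i + 1))
    (hv : IsUnit (vertexMatrix A v).det) : OpenPartialHomeomorph (OrbitSpace A) (Model n) where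
  toFun x := modelEquiv n (orbitCoords A v x)
  invFun y := ofAffineCoords A v ((modelEquiv n).symm y)
  source := vertexDomain A v
  target := Set.univ
  map_source' _ _ := Set.mem_univ _
  map_target' y _ := ofAffineCoords_mem_vertexDomain A v _
  left_inv' x hx := by
    rw [ContinuousLinearEquiv.symm_apply_apply, ofAffineCoords_orbitCoords hv hx]
  right_inv' y _ := by
    rw [orbitCoords_ofAffineCoords hv (by simp), affineCoords_affinePoint,
      ContinuousLinearEquiv.apply_symm_apply]
  open_source := isOpen_vertexDomain A v
  open_target := isOpen_univ
  continuousOn_toFun := by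
    intro x hx
    refine ContinuousAt.continuousWithinAt ((modelEquiv n).continuous.continuousAt.comp ?_)
    obtain ⟨z, rfl⟩ := mk_surjective A x
    rw [← (isOpenQuotientMap_mk A).continuousAt_comp_iff]
    have h : ContinuousAt (fun z => affineCoords A v (coords z)) z :=
      ContinuousAt.comp
        (contDiffAt_affineCoords A v ((mk_mem_vertexDomain A v z).1 hx)).continuousAt
        continuous_coords.continuousAt
    refine h.congr ?_
    filter_upwards [(continuous_mk A).continuousAt.preimage_mem_nhds
      ((isOpen_vertexDomain A v).mem_nhds hx)] with y hy
    exact (orbitCoords_mk hv ((mk_mem_vertexDomain A v y).1 hy)).symm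
  continuousOn_invFun := by
    have h := (contMDiff_normalized_affinePoint (n := n) v 1).continuous
    simp only [rotate_one] at h
    exact ((continuous_mk A).comp h).continuousOn

section SmoothStructure

variable {n : Fin m → ℕ} (A : VectorMatrix n) (hA : ∀ v, IsUnit (vertexMatrix A v).det)

/-- The charts at the vertices cover the orbit space. -/
@[reducible] def orbitChartedSpace : ChartedSpace (Model n) (OrbitSpace A) where
  atlas := Set.range fun v => vertexChart A v (hA v)
  chartAt x := vertexChart A (exists_mem_vertexDomain A x).choose (hA _)
  mem_chart_source x := (exists_mem_vertexDomain A x).choose_spec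
  chart_mem_atlas _ := ⟨_, rfl⟩

theorem orbit_isManifold :
    letI := orbitChartedSpace A hA
    IsManifold 𝓘(ℝ, Model n) ∞ (OrbitSpace A) := by
  let _ := orbitChartedSpace A hA
  refine isManifold_of_contDiffOn _ _ _ ?_
  rintro _ _ ⟨v, rfl⟩ ⟨v', rfl⟩ y hy
  have hy' : ∀ i, affinePoint v ((modelEquiv n).symm y) i (v' i) ≠ 0 := by
    have h : ofAffineCoords A v ((modelEquiv n).symm y) ∈ vertexDomain A v' := by
      simpa [vertexChart] using hy
    exact coords_normalized_affinePoint_ne_zero.1 ((mk_mem_vertexDomain A v' _).1 h)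
  have hs : ContDiffAt ℝ ∞ (fun y => modelEquiv n
      (affineCoords A v' (affinePoint v ((modelEquiv n).symm y)))) y := by
    have h1 : ContDiffAt ℝ ∞ (fun y => affinePoint v ((modelEquiv n).symm y)) y :=
      ((contDiff_affinePoint v).comp (modelEquiv n).symm.contDiff).contDiffAt
    have h2 : ContDiffAt ℝ ∞ (fun y => affineCoords A v' (affinePoint v ((modelEquiv n).symm y)))
        y := ContDiffAt.comp (g := affineCoords A v')
          (f := fun y => affinePoint v ((modelEquiv n).symm y)) y
          (contDiffAt_affineCoords A v' hy') h1
    exact (modelEquiv n).contDiff.contDiffAt.comp y h2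
  refine hs.contDiffWithinAt.congr_of_mem ?_ hy
  intro x hx
  have h : ofAffineCoords A v ((modelEquiv n).symm x) ∈ vertexDomain A v' := by
    simpa [vertexChart] using hx
  exact congrArg (modelEquiv n) (orbitCoords_ofAffineCoords (hA v')
    (coords_normalized_affinePoint_ne_zero.1 ((mk_mem_vertexDomain A v' _).1 h)))

theorem vertexChart_mem_maximalAtlas (v : ∀ i, Fin (n i + 1)) :
    letI := orbitChartedSpace A hA
    vertexChart A v (hA v) ∈ IsManifold.maximalAtlas 𝓘(ℝ, Model n) ∞ (OrbitSpace A) := by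
  let _ := orbitChartedSpace A hA
  have := orbit_isManifold A hA
  exact IsManifold.subset_maximalAtlas ⟨v, rfl⟩

/-- The inverse of a vertex chart is smooth on the whole model space. -/
theorem contMDiff_vertexChart_symm (v : ∀ i, Fin (n i + 1)) :
    letI := orbitChartedSpace A hA
    ContMDiff 𝓘(ℝ, Model n) 𝓘(ℝ, Model n) ∞ (vertexChart A v (hA v)).symm := by
  let _ := orbitChartedSpace A hA
  have := orbit_isManifold A hA
  exact contMDiffOn_univ.1
    (contMDiffOn_symm_of_mem_maximalAtlas (vertexChart_mem_maximalAtlas A hA v))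

theorem orbit_contMDiff_mk :
    letI := orbitChartedSpace A hA
    ContMDiff (sphereModel n) 𝓘(ℝ, Model n) ∞ (OrbitSpace.mk A) := by
  let _ := orbitChartedSpace A hA
  intro z
  obtain ⟨v, hz⟩ := exists_coords_ne_zero z
  have h : ContMDiffAt (sphereModel n) 𝓘(ℝ, Model n) ∞
      (fun z => (vertexChart A v (hA v)).symm (modelEquiv n (affineCoords A v (coords z)))) z :=
    (contMDiff_vertexChart_symm A hA v).contMDiffAt.comp z
      (((modelEquiv n).contDiff.contDiffAt.comp _
        (contDiffAt_affineCoords A v hz)).comp_contMDiffAt contMDiff_coords.contMDiffAt)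
  refine h.congr_of_eventuallyEq ?_
  filter_upwards [(continuous_mk A).continuousAt.preimage_mem_nhds
    ((isOpen_vertexDomain A v).mem_nhds ((mk_mem_vertexDomain A v z).2 hz))] with y hy
  rw [← orbitCoords_mk (hA v) ((mk_mem_vertexDomain A v y).1 hy)]
  exact ((vertexChart A v (hA v)).left_inv hy).symm

/-- Through every point of the product of spheres there passes a smooth section of the quotient
map over a chart. -/
theorem orbit_mfderiv_mk_surjective (z : SphereProd n) :
    letI := orbitChartedSpace A hA
    Function.Surjective (mfderiv (sphereModel n) 𝓘(ℝ, Model n) (OrbitSpace.mk A) z) := by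
  let _ := orbitChartedSpace A hA
  have := orbit_isManifold A hA
  obtain ⟨v, hz⟩ := exists_coords_ne_zero z
  let φ := vertexChart A v (hA v)
  let g := solve A v fun l => phase (coords z l (v l))
  let s : Model n → SphereProd n := fun y => rotate (kWeight A g)
    (normalized (affinePoint v ((modelEquiv n).symm y)) (affinePoint_ne_zero v _))
  have hs : ContMDiff 𝓘(ℝ, Model n) (sphereModel n) ∞ s :=
    contMDiff_normalized_affinePoint v (kWeight A g)
  have hcomp : OrbitSpace.mk A ∘ s = φ.symm := by
    funext y
    exact (mk_eq_iff A _ _).2 ⟨g, rfl⟩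
  let y₀ : Model n := modelEquiv n (affineCoords A v (coords z))
  have hsy : s y₀ = z := by
    have h : ∀ u, u = affineCoords A v (coords z) → rotate (kWeight A g)
        (normalized (affinePoint v u) (affinePoint_ne_zero v u)) = z := by
      rintro _ rfl
      rw [normalized_affineCoords (hA v) z hz, rotate_rotate, ← kWeight_mul, mul_inv_cancel,
        kWeight_one, rotate_one]
    exact h _ ((modelEquiv n).symm_apply_apply _)
  have hd := mfderiv_comp y₀ ((orbit_contMDiff_mk A hA).mdifferentiableAt (by simp))
    (hs.mdifferentiableAt (by simp))
  rw [hcomp, hsy] at hd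
  have hφ : φ.MDifferentiable 𝓘(ℝ, Model n) 𝓘(ℝ, Model n) :=
    mdifferentiable_of_mem_atlas (I := 𝓘(ℝ, Model n)) ⟨v, rfl⟩
  have hsurj := hφ.symm.mfderiv_surjective (x := y₀) (Set.mem_univ _)
  rw [hd] at hsurj
  intro y
  obtain ⟨a, ha⟩ := hsurj y
  exact ⟨_, ha⟩

theorem contMDiff_coe_gWeight (i : Fin m) (j : Fin (n i + 1)) :
    ContMDiff (torusModel n) 𝓘(ℝ, ℂ) ∞ fun t : Torus n => (gWeight t i j : ℂ) := by
  refine Fin.cases ?_ (fun k => ?_) j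
  · simpa using contMDiff_const
  · exact contMDiff_coe_circle.comp
      (contMDiff_apply_pi (fun _ : CoordIdx n => 𝓡 1) (fun _ => Circle) ⟨i, k⟩)

theorem orbit_contMDiffSMul :
    letI := orbitChartedSpace A hA
    ContMDiffSMul (torusModel n) 𝓘(ℝ, Model n) ∞ (Torus n) (OrbitSpace A) := by
  let _ := orbitChartedSpace A hA
  have := orbit_isManifold A hA
  refine ⟨fun p => ?_⟩
  obtain ⟨v, hv⟩ := exists_mem_vertexDomain A p.2
  let φ := vertexChart A v (hA v)
  have hφ : ContMDiffAt ((torusModel n).prod 𝓘(ℝ, Model n)) 𝓘(ℝ, Model n) ∞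
      (fun q : Torus n × OrbitSpace A => φ q.2) p :=
    (contMDiffAt_of_mem_maximalAtlas (vertexChart_mem_maximalAtlas A hA v) hv).comp p
      contMDiffAt_snd
  have hcoord : ContMDiffAt ((torusModel n).prod 𝓘(ℝ, Model n)) 𝓘(ℝ, CoordIdx n → ℂ) ∞
      (fun q : Torus n × OrbitSpace A => fun c : CoordIdx n =>
        (residual A v (gWeight q.1) c.1 ((v c.1).succAbove c.2) : ℂ) *
          orbitCoords A v q.2 c) p := by
    refine contMDiffAt_pi_space.2 fun c => contMDiffAt_coe_mul ?_ ?_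
    · exact contMDiffAt_coe_residual A v
        (fun i j => ((contMDiff_coe_gWeight i j).comp contMDiff_fst).contMDiffAt) _ _
    · have h := (modelEquiv n).symm.contDiff.contDiffAt.comp_contMDiffAt hφ
      refine (contMDiffAt_pi_space.1 h c).congr_of_eventuallyEq
        (Filter.Eventually.of_forall fun q => ?_)
      exact (congrFun ((modelEquiv n).symm_apply_apply (orbitCoords A v q.2)) c).symm
  have h := (contMDiff_vertexChart_symm A hA v).contMDiffAt.comp p
    ((modelEquiv n).contDiff.contDiffAt.comp_contMDiffAt hcoord)
  refine h.congr_of_eventuallyEq ?_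
  filter_upwards [continuous_snd.continuousAt.preimage_mem_nhds
    ((isOpen_vertexDomain A v).mem_nhds hv)] with q hq
  rw [← (vertexChart A v (hA v)).left_inv (smul_mem_vertexDomain q.1 hq)]
  refine congrArg (vertexChart A v (hA v)).symm (congrArg (modelEquiv n) ?_)
  funext c
  exact orbitCoords_smul (hA v) q.1 hq c

end SmoothStructure

/-! ### The representations of the residual torus in the charts -/

/-- Diagonal complex matrices with entries in the circle, as endomorphisms of `ℂ ^ n`. -/
def diagonalHom (ι : Type*) [Fintype ι] : (ι → Circle) →* ((ι → ℂ) →L[ℝ] (ι → ℂ)) where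
  toFun w := ContinuousLinearMap.pi fun c => (w c : ℂ) • ContinuousLinearMap.proj (R := ℝ) c
  map_one' := by ext; simp
  map_mul' w w' := by
    refine ContinuousLinearMap.ext fun u => funext fun c => ?_
    simp [mul_assoc]

/-- The characters by which the residual torus acts on the affine coordinates at `v`. -/
def vertexCharacters {n : Fin m → ℕ} (A : VectorMatrix n) (v : ∀ i, Fin (n i + 1)) :
    Torus n →* (CoordIdx n → Circle) :=
  MonoidHom.mk' (fun t c => residual A v (gWeight t) c.1 ((v c.1).succAbove c.2)) fun t u => by
    funext c
    rw [gWeight_mul, residual_mul]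
    rfl

/-- The representation of the residual torus on the model space for which the chart at `v` is
equivariant. -/
def vertexRep {n : Fin m → ℕ} (A : VectorMatrix n) (v : ∀ i, Fin (n i + 1)) :
    Torus n →* (Model n →L[ℝ] Model n) :=
  ((modelEquiv n).conjContinuousAlgEquiv : _ →* _).comp
    ((diagonalHom (CoordIdx n)).comp (vertexCharacters A v))

theorem vertexRep_apply {n : Fin m → ℕ} (A : VectorMatrix n) (v : ∀ i, Fin (n i + 1))
    (t : Torus n) (u : CoordIdx n → ℂ) : vertexRep A v t (modelEquiv n u) =
      modelEquiv n fun c => vertexCharacters A v t c * u c := by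
  have h : vertexRep A v t (modelEquiv n u) = modelEquiv n
      (diagonalHom _ (vertexCharacters A v t) ((modelEquiv n).symm (modelEquiv n u))) := rfl
  rw [h, ContinuousLinearEquiv.symm_apply_apply]
  rfl

theorem vertexRep_injective {n : Fin m → ℕ} {A : VectorMatrix n} {v : ∀ i, Fin (n i + 1)}
    (hv : IsUnit (vertexMatrix A v).det) : Function.Injective (vertexRep A v) := by
  refine (injective_iff_map_eq_one _).2 fun t ht => eq_one_of_residual_gWeight hv fun c => ?_
  have h := vertexRep_apply A v t 1
  rw [ht, one_apply_eq_self, (modelEquiv n).injective.eq_iff] at h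
  exact Circle.ext (by simpa [vertexCharacters] using (congrFun h c).symm)

theorem vertexRep_continuous {n : Fin m → ℕ} (A : VectorMatrix n) (v : ∀ i, Fin (n i + 1)) :
    Continuous (vertexRep A v) := by
  rw [continuous_clm_apply]
  intro y
  obtain ⟨u, rfl⟩ := (modelEquiv n).surjective y
  simp only [vertexRep_apply]
  refine (modelEquiv n).continuous.comp (continuous_pi fun c => ?_)
  have h : ContMDiff (torusModel n) 𝓘(ℝ, ℂ) ∞ fun t : Torus n => (vertexCharacters A v t c : ℂ) :=
    fun t => contMDiffAt_coe_residual A v (fun i j => (contMDiff_coe_gWeight i j).contMDiffAt) _ _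
  exact h.continuous.mul continuous_const

/-! ### Fibers and isotropy groups -/

theorem proj_surjective {n : Fin m → ℕ} (A : VectorMatrix n) :
    Function.Surjective (OrbitSpace.proj A) := by
  intro p
  let y : ∀ i, Fin (n i + 1) → ℂ := fun i j => (Real.sqrt ((p i).1 j) : ℂ)
  have hy : ∀ i, ‖WithLp.toLp 2 (y i)‖ = 1 := fun i => by
    rw [EuclideanSpace.norm_eq, Real.sqrt_eq_one]
    simp only [y, Complex.norm_real, sq_abs, Real.norm_eq_abs, Real.sq_sqrt ((p i).2.1 _)]
    exact (p i).2.2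
  let z : SphereProd n := fun i => ⟨WithLp.toLp 2 (y i), mem_sphere_zero_iff_norm.2 (hy i)⟩
  refine ⟨OrbitSpace.mk A z, funext fun i => Subtype.ext (funext fun j => ?_)⟩
  change ‖(Real.sqrt ((p i).1 j) : ℂ)‖ ^ 2 = (p i).1 j
  rw [Complex.norm_real, Real.norm_eq_abs, sq_abs, Real.sq_sqrt ((p i).2.1 j)]

theorem fiber_proj_eq_orbit {n : Fin m → ℕ} (A : VectorMatrix n) (x : OrbitSpace A) :
    OrbitSpace.proj A ⁻¹' {OrbitSpace.proj A x} = MulAction.orbit (Torus n) x := by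
  ext x'
  rw [Set.mem_preimage, Set.mem_singleton_iff, MulAction.mem_orbit_iff]
  constructor
  · intro h
    obtain ⟨z, rfl⟩ := mk_surjective A x
    obtain ⟨z', rfl⟩ := mk_surjective A x'
    obtain ⟨w, rfl⟩ := exists_rotate_of_sqAbs_eq (z := z) (z' := z') h.symm
    exact ⟨torusPart A w, torusPart_smul_mk A w z⟩
  · rintro ⟨t, rfl⟩
    exact proj_smul A t x

theorem isQuotientMap_proj {n : Fin m → ℕ} (A : VectorMatrix n) :
    Topology.IsQuotientMap (OrbitSpace.proj A) :=
  (continuous_proj A).isClosedMap.isQuotientMap (continuous_proj A) (proj_surjective A)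

/-- Extension by `1` of a family of elements of the circle indexed by a set of coordinates. -/
def extendOne {n : Fin m → ℕ} (S : Set (FacetIdx n)) (u : S → Circle) :
    ∀ i, Fin (n i + 1) → Circle :=
  fun i j => Function.extend Subtype.val u 1 (⟨i, j⟩ : FacetIdx n)

theorem extendOne_coe {n : Fin m → ℕ} {S : Set (FacetIdx n)} (u : S → Circle) (f : S) :
    extendOne S u f.1.1 f.1.2 = u f :=
  Subtype.val_injective.extend_apply u 1 f

theorem extendOne_of_notMem {n : Fin m → ℕ} {S : Set (FacetIdx n)} (u : S → Circle)
    {i : Fin m} {j : Fin (n i + 1)} (h : (⟨i, j⟩ : FacetIdx n) ∉ S) : extendOne S u i j = 1 :=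
  Function.extend_apply' (f := (Subtype.val : S → FacetIdx n)) u (1 : FacetIdx n → Circle) _ <| by
    rintro ⟨f, hf⟩
    exact h (hf ▸ f.2)

/-- The isotropy group of `[z]` is isomorphic to the torus of the rotations of the coordinates
that vanish at `z`. -/
theorem nonempty_stabilizer_equiv {n : Fin m → ℕ} {A : VectorMatrix n}
    (hA : ∀ v, IsUnit (vertexMatrix A v).det) (x : OrbitSpace A) : Nonempty
      (MulAction.stabilizer (Torus n) x ≃ₜ*
        ({f : FacetIdx n // OrbitSpace.proj A x ∈ facet n f} → Circle)) := by
  obtain ⟨z, rfl⟩ := mk_surjective A x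
  let S : Set (FacetIdx n) := {f | OrbitSpace.proj A (OrbitSpace.mk A z) ∈ facet n f}
  have hS : ∀ i j, (⟨i, j⟩ : FacetIdx n) ∈ S ↔ coords z i j = 0 := fun i j =>
    mem_facet_sqAbs z ⟨i, j⟩
  have hfix : ∀ u : S → Circle, rotate (extendOne S u) z = z := fun u =>
    (rotate_eq_self_iff _ z).2 fun i j hij => extendOne_of_notMem u fun h => hij ((hS i j).1 h)
  let ψ : (S → Circle) →* MulAction.stabilizer (Torus n) (OrbitSpace.mk A z) :=
    MonoidHom.mk' (fun u => ⟨torusPart A (extendOne S u),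
      (mem_stabilizer_mk_iff A z _).2 ⟨_, hfix u, rfl⟩⟩) fun u u' => by
        apply Subtype.ext
        change torusPart A (extendOne S (u * u')) = torusPart A _ * torusPart A _
        rw [← torusPart_mul]
        congr 1
        funext i j
        by_cases h : (⟨i, j⟩ : FacetIdx n) ∈ S
        · have h1 := fun u : S → Circle => extendOne_coe u ⟨_, h⟩
          simp only [Pi.mul_apply] at h1 ⊢
          rw [h1, h1, h1, Pi.mul_apply]
        · simp [extendOne_of_notMem _ h]
  have hψ : Continuous ψ := by
    refine Continuous.subtype_mk ?_ _
    have h1 : Continuous (extendOne S) := continuous_pi fun i => continuous_pi fun j => by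
      by_cases h : (⟨i, j⟩ : FacetIdx n) ∈ S
      · exact (continuous_apply (⟨_, h⟩ : S)).congr fun u => (extendOne_coe u ⟨_, h⟩).symm
      · exact continuous_const.congr fun u => (extendOne_of_notMem u h).symm
    have h2 : ∀ i j, Continuous fun u => extendOne S u i j := fun i j =>
      (continuous_apply j).comp ((continuous_apply i).comp h1)
    refine continuous_pi fun c => (h2 _ _).mul (Continuous.inv ?_)
    exact (continuous_apply _).comp ((continuous_apply _).comp
      ((continuous_kWeight A).comp (continuous_pi fun l => h2 l 0)))
  have hbij : Function.Bijective ψ := by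
    constructor
    · refine (injective_iff_map_eq_one ψ).2 fun u hu => ?_
      have h1 : torusPart A (extendOne S u) = 1 := congrArg Subtype.val hu
      have h2 := kWeight_mul_gWeight_torusPart A (extendOne S u)
      rw [h1, gWeight_one, mul_one] at h2
      -- the rotation is given by an element of `K` that fixes `z`
      have h3 := hfix u
      rw [← h2] at h3
      rw [eq_one_of_rotate_kWeight_eq hA h3, kWeight_one] at h2
      funext f
      rw [← extendOne_coe u f, ← h2]
      rfl
    · rintro ⟨t, ht⟩
      obtain ⟨w, hw, rfl⟩ := (mem_stabilizer_mk_iff A z t).1 ht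
      refine ⟨fun f => w f.1.1 f.1.2, Subtype.ext ?_⟩
      change torusPart A _ = torusPart A w
      congr 1
      funext i j
      by_cases h : (⟨i, j⟩ : FacetIdx n) ∈ S
      · exact extendOne_coe _ ⟨_, h⟩
      · rw [extendOne_of_notMem _ h]
        exact ((rotate_eq_self_iff w z).1 hw i j fun h0 => h ((hS i j).2 h0)).symm
  -- the inverse is continuous by compactness
  let e := MulEquiv.ofBijective ψ hbij
  let h := Continuous.homeoOfEquivCompactToT2 (f := e.toEquiv) hψ
  exact ⟨(ContinuousMulEquiv.mk e h.continuous_toFun h.continuous_invFun).symm⟩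

/-! ### The characteristic function -/

/-- The exponents of the circle subgroup of the residual torus that fixes the points with
`z^i_j = 0`. -/
def facetExponents {n : Fin m → ℕ} (A : VectorMatrix n) (f : FacetIdx n) : CoordIdx n → ℤ :=
  Fin.cases (fun c => A f.1 c.1 c.2) (fun k => Pi.single ⟨f.1, k⟩ 1) f.2

/-- The circle subgroup of the facet `F^i_j` is the residual part of the rotations of the
coordinate `z^i_j`, with the opposite orientation if `j = 0`. -/
theorem torusPart_mulSingle {n : Fin m → ℕ} (A : VectorMatrix n) (f : FacetIdx n) (c : Circle) :
    torusPart A (extendOne {f} fun _ => if f.2 = 0 then c⁻¹ else c) =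
      (cocharEquiv n (facetExponents A f)).toMul c := by
  obtain ⟨i, j⟩ := f
  have hne : ∀ (u : ({⟨i, j⟩} : Set (FacetIdx n)) → Circle) (i' : Fin m) (j' : Fin (n i' + 1)),
      (⟨i', j'⟩ : FacetIdx n) ≠ ⟨i, j⟩ → extendOne _ u i' j' = 1 := fun u i' j' h =>
    extendOne_of_notMem u (by simpa using h)
  have heq : ∀ u : ({⟨i, j⟩} : Set (FacetIdx n)) → Circle, extendOne _ u i j = u ⟨_, rfl⟩ :=
    fun u => extendOne_coe u ⟨⟨i, j⟩, rfl⟩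
  funext x
  obtain ⟨i', k'⟩ := x
  rw [toMul_cocharEquiv_apply, torusPart]
  induction j using Fin.cases with
  | zero =>
    have hk : (⟨i', k'.succ⟩ : FacetIdx n) ≠ ⟨i, 0⟩ := fun h => by
      obtain ⟨rfl, h⟩ := Sigma.mk.inj_iff.1 h
      exact Fin.succ_ne_zero k' (eq_of_heq h)
    rw [hne _ _ _ hk, one_mul, kWeight_eq_prod, Finset.prod_eq_single i]
    · rw [heq]
      simp [weightExp, facetExponents]
    · intro l _ hl
      rw [hne _ _ _ (by simp [hl]), one_zpow]
    · simp
  | succ k =>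
    have h0 : (fun l => extendOne ({⟨i, k.succ⟩} : Set (FacetIdx n))
        (fun _ => if k.succ = 0 then c⁻¹ else c) l 0) = 1 := by
      funext l
      refine hne _ _ _ fun h => ?_
      obtain ⟨rfl, h⟩ := Sigma.mk.inj_iff.1 h
      exact Fin.succ_ne_zero k (eq_of_heq h).symm
    rw [h0, kWeight_one]
    by_cases h : (⟨i', k'⟩ : CoordIdx n) = ⟨i, k⟩
    · obtain ⟨rfl, h⟩ := Sigma.mk.inj_iff.1 h
      obtain rfl := eq_of_heq h
      rw [heq]
      simp [facetExponents]
    · rw [hne _ _ _ fun h' => h ?_]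
      · simp [facetExponents, h]
      · obtain ⟨h1, h2⟩ := Sigma.mk.inj_iff.1 h'
        change i' = i at h1
        subst h1
        rw [← Fin.succ_injective _ (eq_of_heq h2)]

theorem hasAssociatedMatrix_proj {n : Fin m → ℕ} (hn : ∀ i, 1 ≤ n i) {A : VectorMatrix n}
    (hA : A.UnimodularMinors) : HasAssociatedMatrix (OrbitSpace.proj A) A := by
  refine ⟨fun f => cocharEquiv n (facetExponents A f), fun f => ⟨?_, ?_⟩, cocharBasis n, ?_, ?_⟩
  · obtain ⟨i, j⟩ := f
    induction j using Fin.cases with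
    | zero =>
      -- the entries on the diagonal are principal minors of size one
      refine isPrimitiveVector_cocharEquiv (x := ⟨i, ⟨0, hn i⟩⟩) ?_
      have h := hA (fun j => ⟨0, hn j⟩) {i}
      rw [Matrix.det_unique] at h
      rw [Int.isUnit_iff]
      simpa [VectorMatrix.select, facetExponents] using h
    | succ k =>
      refine isPrimitiveVector_cocharEquiv (x := ⟨i, k⟩) ?_
      simp [facetExponents]
  · intro x hx
    obtain ⟨z, rfl⟩ := mk_surjective A x
    have hz : ∀ f', coords z f'.1 f'.2 = 0 ↔ f' = f := fun f' => by
      rw [← mem_facet_sqAbs]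
      exact ⟨hx.2 f', fun h => h ▸ hx.1⟩
    ext t
    rw [mem_stabilizer_mk_iff, MonoidHom.mem_range]
    constructor
    · rintro ⟨w, hw, rfl⟩
      refine ⟨if f.2 = 0 then (w f.1 f.2)⁻¹ else w f.1 f.2, ?_⟩
      refine (torusPart_mulSingle A f _).symm.trans (congrArg _ ?_)
      funext i j
      by_cases h : (⟨i, j⟩ : FacetIdx n) = f
      · subst h
        refine (extendOne_coe (S := {⟨i, j⟩}) _ ⟨⟨i, j⟩, rfl⟩).trans ?_
        split_ifs <;> simp
      · rw [extendOne_of_notMem _ (by simpa using h)]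
        exact ((rotate_eq_self_iff w z).1 hw i j fun h0 => h ((hz ⟨i, j⟩).1 h0)).symm
    · rintro ⟨c, rfl⟩
      refine ⟨_, ?_, torusPart_mulSingle A f c⟩
      refine (rotate_eq_self_iff _ z).2 fun i j hij => extendOne_of_notMem _ fun h => hij ?_
      exact (hz ⟨i, j⟩).2 h
  · intro i k
    exact cocharBasis_apply _
  · intro i j k
    exact cocharBasis_repr _ _

theorem isQuasitoricManifold_proj {n : Fin m → ℕ} {A : VectorMatrix n}
    (hA : ∀ v, IsUnit (vertexMatrix A v).det) :
    letI := orbitChartedSpace A hA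
    IsQuasitoricManifold n (OrbitSpace A) (OrbitSpace.proj A) :=
  letI := orbitChartedSpace A hA
  { isManifold := orbit_isManifold A hA
    t2Space := inferInstance
    secondCountable := inferInstance
    smooth_smul := orbit_contMDiffSMul A hA
    locally_representation := fun x => by
      obtain ⟨v, hx⟩ := exists_mem_vertexDomain A x
      refine ⟨vertexRep A v, vertexChart A v (hA v), vertexRep_continuous A v,
        vertexRep_injective (hA v), vertexChart_mem_maximalAtlas A hA v, hx,
        fun t y hy => ⟨smul_mem_vertexDomain t hy, ?_⟩⟩
      refine Eq.trans ?_ (vertexRep_apply A v t (orbitCoords A v y)).symm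
      exact congrArg (modelEquiv n) (funext (orbitCoords_smul (hA v) t hy))
    fiber_eq_orbit := fun p => by
      obtain ⟨x, rfl⟩ := proj_surjective A p
      exact ⟨x, fiber_proj_eq_orbit A x⟩
    isQuotientMap := isQuotientMap_proj A
    stabilizer_torus := nonempty_stabilizer_equiv hA }

end Quasitoric

end

theorem proposition4p3 {m : ℕ} (n : Fin m → ℕ) (hn : ∀ i, 1 ≤ n i)
    (A : Quasitoric.VectorMatrix n) (hA : A.UnimodularMinors) :
    (@IsCancelSMul (Fin m → Circle) (Quasitoric.SphereProd n) (Quasitoric.kAction A).toSMul) ∧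
    ∃ _ : ChartedSpace (Quasitoric.Model n) (Quasitoric.OrbitSpace A),
      ContMDiff (Quasitoric.sphereModel n) (𝓘(ℝ, Quasitoric.Model n)) ∞
        (Quasitoric.OrbitSpace.mk A) ∧
      (∀ z : Quasitoric.SphereProd n, Function.Surjective
        (mfderiv (Quasitoric.sphereModel n) (𝓘(ℝ, Quasitoric.Model n))
          (Quasitoric.OrbitSpace.mk A) z)) ∧
      Quasitoric.IsQuasitoricManifold n (Quasitoric.OrbitSpace A)
        (Quasitoric.OrbitSpace.proj A) ∧
      Quasitoric.HasAssociatedMatrix (Quasitoric.OrbitSpace.proj A) A := by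
  have hv := Quasitoric.isUnit_det_vertexMatrix hn hA
  refine ⟨?_, Quasitoric.orbitChartedSpace A hv, Quasitoric.orbit_contMDiff_mk A hv,
    Quasitoric.orbit_mfderiv_mk_surjective A hv, Quasitoric.isQuasitoricManifold_proj hv,
    Quasitoric.hasAssociatedMatrix_proj hn hA⟩
  let _ := Quasitoric.kAction A
  refine ⟨fun g h z hgh => ?_⟩
  have h1 : (h⁻¹ * g) • z = z := by rw [mul_smul, hgh, inv_smul_smul]
  exact (inv_mul_eq_one.1 (Quasitoric.eq_one_of_rotate_kWeight_eq hv h1)).symm
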